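/- Write $[n]=\{1,\dots,n\}$ and let $\Sigma_n$ be the set of permutations of $[n]$. A *partial permutation* of size $t$ is an injection $\nu:S\to[n]$ whose domain (support) $S\subset[n]$ has $t$ elements; $\Sigma_n^{(t)}$ denotes the set of all of them (so $\Sigma_n=\Sigma_n^{(n)}$). Partial permutations $\nu_1,\dots,\nu_s$ form a *sunflower with $s$ petals and core of size $m$* if there is a set $X\subset[n]$ with $|X|=m$ such that all $\nu_i$ are defined on $X$ and $\nu_1(x)=\dots=\nu_s(x)$ for every $x\in X$, while for every $x\in[n]\setminus X$ the values $\nu_i(x)$, over those $i$ for which $\nu_i$ is defined at $x$, are pairwise distinct. For $\mathcal F\subset\Sigma_n$ and a family $\mathcal T$ of partial permutations, let $\mathcal F[\mathcal T]$ be the set of those $\sigma\in\mathcal F$ for which some $\nu\in\mathcal T$ coincides with $\sigma$ on the support of $\nu$. Let $n\ge 2$, $s\ge 1$, $t\ge 2$ be integers with $$n\ \ge\ 2^{20}\,s\,(t+1)\,\log_2 n ,$$ and let $\mathcal F\subset\Sigma_n$ contain no sunflower with $s$ petals and core of size at most $t-1$. Then there exists a family $\mathcal T\subset\Sigma_n^{(t)}$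 that contains no sunflower with $s$ petals and core of size at most $t-1$ and satisfies $$|\mathcal F\setminus\mathcal F[\mathcal T]|\ \le\ (2^{14}s\log_2 t)^t\cdot\frac{2^{21}\,s\,(t+1)\,\log_2(n/4)}{n}\cdot(n-t)!\,.$$ -/

import Mathlib

namespace PermSunflower

/-- The permutations `σ 0, …, σ (s - 1)` of `[n]` form a sunflower with `s` petals and core `X`:
they all agree at every point of `X`, and at every point outside `X` their values are pairwise
distinct. -/
def IsSunflower {n s : ℕ} (σ : Fin s → Equiv.Perm (Fin n)) (X : Finset (Fin n)) : Prop :=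
  (∀ x ∈ X, ∀ i j, σ i x = σ j x) ∧ ∀ x ∉ X, ∀ i j, i ≠ j → σ i x ≠ σ j x

/-- The family `F` of permutations contains a sunflower with `s` petals and core of size at
most `m`. -/
def HasSunflower {n : ℕ} (F : Set (Equiv.Perm (Fin n))) (s m : ℕ) : Prop :=
  ∃ (σ : Fin s → Equiv.Perm (Fin n)) (X : Finset (Fin n)),
    (∀ i, σ i ∈ F) ∧ X.card ≤ m ∧ IsSunflower σ X

/-- The support of a partial permutation `ν`, that is, of an injection from a subset of `[n]`
to `[n]`: the set of points at which `ν` is defined. -/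
def support {n : ℕ} (ν : Fin n ≃. Fin n) : Set (Fin n) :=
  {x | ∃ y, ν x = some y}

/-- The family of all partial permutations of `[n]` of size `t`. -/
def partialPerms (n t : ℕ) : Set (Fin n ≃. Fin n) :=
  {ν | (support ν).ncard = t}

/-- The partial permutations `ν 0, …, ν (s - 1)` form a sunflower with `s` petals and core `X`:
they are all defined and agree at every point of `X`, and at every point outside `X` those of
them that are defined there take pairwise distinct values. Equivalently, any two of the graphs
of the `ν i` meet exactly in the common graph over `X`. -/
def IsPartialSunflower {n s : ℕ} (ν : Fin s → (Fin n ≃. Fin n)) (X : Finset (Fin n)) : Prop :=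
  (∀ x ∈ X, ∃ y, ∀ i, ν i x = some y) ∧
    ∀ x ∉ X, ∀ i j, i ≠ j → ∀ y z, ν i x = some y → ν j x = some z → y ≠ z

/-- The family `T` of partial permutations contains a sunflower with `s` petals and core of
size at most `m`. -/
def HasPartialSunflower {n : ℕ} (T : Set (Fin n ≃. Fin n)) (s m : ℕ) : Prop :=
  ∃ (ν : Fin s → (Fin n ≃. Fin n)) (X : Finset (Fin n)),
    (∀ i, ν i ∈ T) ∧ X.card ≤ m ∧ IsPartialSunflower ν X

/-- The family `F[T]` of all permutations in `F` that coincide with some member of `T` on the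
support of that member. -/
def restrictTo {n : ℕ} (F : Set (Equiv.Perm (Fin n))) (T : Set (Fin n ≃. Fin n)) :
    Set (Equiv.Perm (Fin n)) :=
  {σ | σ ∈ F ∧ ∃ ν ∈ T, ∀ x ∈ support ν, ν x = some (σ x)}

end PermSunflower

open Finset

/-! This is the spread approximation method. A permutation is identified with its graph, an
`n`-element subset of `[n] × [n]`. Sunflowers of (partial) permutations become sunflowers of sets,
and at most `(n - #Y)!` permutations contain a given set `Y`.

A family `G` of sets containing `X` is `r`-spread over `X` if for every `Z ⊇ X` the fraction of
members containing `Z` is at most `r ^ (#X - #Z)`. The engine is the spread lemma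
`card_bad_colourings_le`: if `r` is at least 64 times the number of colours, then in all but a `k /
2 ^ m` fraction of colourings the union of `m` prescribed classes contains a member. Giving each
petal its own colours yields `IsFlower.exists_replacement`: a sunflower whose petals carry spread
families lifts to a sunflower with the same core, taken from those families.

Let `H` consist of the sets of size at most `q` over which some nonempty subfamily of `F` is spread.
Lifting shows that `H` inherits sunflower-freeness, and few permutations contain no member of `H`
(`exists_spread_cover`). Extend `H` to a maximal sunflower-free family `U` and keep its
inclusion-minimal members. Those of size `t` form the approximating family. Those of size `i > t`
number at most `r' ^ t * r ^ (i - t)` (`card_minimal_le`), because maximality puts into `U` every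
admissible set over which a subfamily of `U` is spread. Each lies in at most `(n - i)!`
permutations, and the sum over `i` is geometric with ratio of order `s (t + 1) log n / n`. -/

namespace SpreadApprox

set_option linter.unusedSectionVars false

/-! ### Minimum fragments -/

section Fragment

variable {α ι : Type*} [DecidableEq α] [Fintype ι]

theorem exists_fragment (S : ι → Finset α) (W : Finset α) (i : ι) :
    ∃ j, S j ⊆ W ∪ S i ∧ #(S j) ≤ #(S i) ∧
      ∀ j', S j' ⊆ W ∪ S i → #(S j') ≤ #(S i) → #(S j \ W) ≤ #(S j' \ W) := by
  classical
  obtain ⟨j, hj, hmin⟩ := Finset.exists_min_image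
    (univ.filter fun j => S j ⊆ W ∪ S i ∧ #(S j) ≤ #(S i)) (fun j => #(S j \ W))
    ⟨i, by simp⟩
  simp only [mem_filter, mem_univ, true_and] at hj hmin
  exact ⟨j, hj.1, hj.2, fun j' h h' => hmin j' ⟨h, h'⟩⟩

/-- The minimum fragment of `S i` with respect to `W`: a set `S j \ W` of least size, over those
`S j` contained in `W ∪ S i` that are not larger than `S i`. -/
noncomputable def fragment (S : ι → Finset α) (W : Finset α) (i : ι) : Finset α :=
  S (exists_fragment S W i).choose \ W

theorem fragment_subset (S : ι → Finset α) (W : Finset α) (i : ι) : fragment S W i ⊆ S i := by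
  intro x hx
  rw [fragment, mem_sdiff] at hx
  have := (exists_fragment S W i).choose_spec.1 hx.1
  simpa [hx.2] using this

theorem disjoint_fragment (S : ι → Finset α) (W : Finset α) (i : ι) :
    Disjoint (fragment S W i) W := sdiff_disjoint

theorem exists_subset_fragment_union (S : ι → Finset α) (W : Finset α) (i : ι) :
    ∃ j, S j ⊆ fragment S W i ∪ W ∧ #(S j) ≤ #(S i) :=
  ⟨_, by rw [fragment]; simp, (exists_fragment S W i).choose_spec.2.1⟩

theorem card_fragment_le (S : ι → Finset α) (W : Finset α) (i j : ι) (hj : S j ⊆ W ∪ S i)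
    (hc : #(S j) ≤ #(S i)) : #(fragment S W i) ≤ #(S j \ W) :=
  (exists_fragment S W i).choose_spec.2.2 j hj hc

theorem fragment_eq_empty (S : ι → Finset α) (W : Finset α) (i j : ι) (hj : S j = ∅) :
    fragment S W i = ∅ := by
  have := card_fragment_le S W i j (by simp [hj]) (by simp [hj])
  simpa [hj] using this

theorem exists_min_member (S : ι → Finset α) (Z : Finset α) :
    ∃ V : Finset α, (∃ j, S j ⊆ Z) →
      (∃ j, V = S j) ∧ V ⊆ Z ∧ ∀ j, S j ⊆ Z → #V ≤ #(S j) := by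
  classical
  by_cases h : ∃ j, S j ⊆ Z
  · obtain ⟨j, hj, hmin⟩ := Finset.exists_min_image (univ.filter fun j => S j ⊆ Z)
      (fun j => #(S j)) (by simpa [Finset.Nonempty] using h)
    simp only [mem_filter, mem_univ, true_and] at hj hmin
    exact ⟨S j, fun _ => ⟨⟨j, rfl⟩, hj, hmin⟩⟩
  · exact ⟨∅, fun h' => absurd h' h⟩

/-- A member of least size among those contained in `Z` (if there are any). -/
noncomputable def minMember (S : ι → Finset α) (Z : Finset α) : Finset α :=
  (exists_min_member S Z).choose

/-- This is why fragments are cheap to encode: a fragment is a subset of a set that depends only on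
its union with `W`. The least member inside that union competes in the definition of the fragment,
so its part outside `W` cannot be smaller than the fragment. -/
theorem fragment_subset_minMember (S : ι → Finset α) (W : Finset α) (i : ι) :
    fragment S W i ⊆ minMember S (W ∪ fragment S W i) ∧
      #(minMember S (W ∪ fragment S W i)) ≤ #(S i) := by
  obtain ⟨j₀, hj₀, hc₀⟩ := exists_subset_fragment_union S W i
  rw [union_comm] at hj₀
  obtain ⟨⟨j, hj⟩, hsub, hmin⟩ := (exists_min_member S (W ∪ fragment S W i)).choose_spec ⟨j₀, hj₀⟩
  change minMember S (W ∪ fragment S W i) = S j at hj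
  change minMember S (W ∪ fragment S W i) ⊆ _ at hsub
  change ∀ j', S j' ⊆ _ → #(minMember S (W ∪ fragment S W i)) ≤ _ at hmin
  have hc : #(minMember S (W ∪ fragment S W i)) ≤ #(S i) := (hmin j₀ hj₀).trans hc₀
  refine ⟨?_, hc⟩
  rw [hj] at hsub hc ⊢
  have h1 : #(fragment S W i) ≤ #(S j \ W) :=
    card_fragment_le S W i j (hsub.trans (union_subset_union_right (fragment_subset S W i))) hc
  have h2 : S j \ W ⊆ fragment S W i := by
    intro x hx
    rw [mem_sdiff] at hx
    simpa [hx.2] using hsub hx.1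
  rw [← eq_of_subset_of_card_le h2 h1]
  exact sdiff_subset

theorem card_le_sum_card (S : ι → Finset α) (hS : ∀ i, (S i).Nonempty) :
    (Fintype.card ι : ℝ) ≤ ∑ i, (#(S i) : ℝ) := by
  have h : ∑ _i : ι, 1 ≤ ∑ i, #(S i) := Finset.sum_le_sum fun i _ => (hS i).card_pos
  rw [Finset.sum_const, Finset.card_univ, smul_eq_mul, mul_one] at h
  exact_mod_cast h

end Fragment

/-! ### The spread lemma, by repeated sampling of colour classes -/

section Round

variable {α ι κ : Type*} [Fintype α] [DecidableEq α] [Fintype ι] [Fintype κ] [DecidableEq κ]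

/-- The set of points that get colour `a`. -/
def colourClass (c : α → κ) (a : κ) : Finset α := univ.filter fun x => c x = a

theorem mem_colourClass (c : α → κ) (a : κ) (x : α) : x ∈ colourClass c a ↔ c x = a := by
  rw [colourClass, mem_filter]
  simp

/-- The colouring `c` with all points of `T` recoloured to `a`. -/
def recolour (c : α → κ) (T : Finset α) (a : κ) : α → κ := fun x => if x ∈ T then a else c x

theorem colourClass_recolour (c : α → κ) (T : Finset α) (a : κ) :
    colourClass (recolour c T a) a = colourClass c a ∪ T := by
  ext x
  by_cases hx : x ∈ T <;> simp [mem_colourClass, recolour, hx]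

/-- Off `T` the colouring `c` is determined by `c'`; on `T` it is free. -/
theorem card_recolour_fiber_le (c' : α → κ) (T : Finset α) (a : κ) :
    #(univ.filter fun c : α → κ => recolour c T a = c') ≤ Fintype.card κ ^ #T := by
  have : Fintype.card (T → κ) = Fintype.card κ ^ #T := by simp
  rw [← this, ← Finset.card_univ]
  refine Finset.card_le_card_of_injOn (fun c x => c x) (fun _ _ => mem_coe.2 (mem_univ _)) ?_
  intro c hc d hd hcd
  simp only [coe_filter, mem_univ, true_and, Set.mem_ofPred_eq] at hc hd
  funext x
  by_cases hx : x ∈ T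
  · exact congrFun hcd ⟨x, hx⟩
  · have h := congrFun (hc.trans hd.symm) x
    simpa [recolour, hx] using h

/-- Here `#T ≥ 1` and `4 * #T ≥ #V + 1`, so each term is at most `2 ^ (-5 * #T) ≤ 2 ^ (-#V - 2)`,
and there are at most `2 ^ #V` terms. -/
theorem sum_large_subsets_le (V : Finset α) {x : ℝ} (hx0 : 0 ≤ x) (hx : x ≤ 1 / 64) :
    ∑ T ∈ V.powerset with #V < 4 * #T, (#T : ℝ) * x ^ #T ≤ 1 / 4 := by
  have key : ∀ T ∈ V.powerset.filter fun T => #V < 4 * #T,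
      (#T : ℝ) * x ^ #T ≤ (1 / 4) / 2 ^ #V := by
    intro T hT
    have hT' : #V + 1 ≤ 4 * #T := (mem_filter.1 hT).2
    have h1 : (#T : ℝ) ≤ 2 ^ #T := by exact_mod_cast Nat.lt_two_pow_self.le
    have h2 : x ^ #T ≤ (1 / 64) ^ #T := by gcongr
    have h3 : (#T : ℝ) * x ^ #T ≤ (1 / 2) ^ (5 * #T) := by
      calc (#T : ℝ) * x ^ #T ≤ 2 ^ #T * (1 / 64) ^ #T := by gcongr
        _ = (1 / 2) ^ (5 * #T) := by rw [← mul_pow, pow_mul]; norm_num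
    have h4 : ((1 : ℝ) / 2) ^ (5 * #T) ≤ (1 / 2) ^ (#V + 2) :=
      pow_le_pow_of_le_one (by norm_num) (by norm_num) (by omega)
    refine (h3.trans h4).trans (le_of_eq ?_)
    rw [pow_add, one_div_pow]; ring
  refine (Finset.sum_le_sum key).trans ?_
  rw [sum_const, nsmul_eq_mul]
  have hcard : (#(V.powerset.filter fun T => #V < 4 * #T) : ℝ) ≤ 2 ^ #V := by
    have := (card_filter_le V.powerset fun T => #V < 4 * #T)
    rw [card_powerset] at this
    exact_mod_cast this
  calc _ ≤ (2 : ℝ) ^ #V * ((1 / 4) / 2 ^ #V) := by gcongr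
    _ = 1 / 4 := by field_simp

/-- One round of random sampling halves the average size of the fragments. -/
theorem sum_card_fragment_le (S : (α → κ) → ι → Finset α) (a : κ) {r : ℝ} (hr : 0 < r)
    (hM : 64 * (Fintype.card κ : ℝ) ≤ r)
    (hS : ∀ c i T, T ⊆ S c i → S (recolour c T a) = S c)
    (hspread : ∀ c T, (#(univ.filter fun i => T ⊆ S c i) : ℝ) * r ^ #T ≤ Fintype.card ι) :
    ∑ c, ∑ i, (#(fragment (S c) (colourClass c a) i) : ℝ) ≤
      1 / 2 * ∑ c, ∑ i, (#(S c i) : ℝ) := by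
  classical
  set f : (α → κ) → ι → Finset α := fun c i => fragment (S c) (colourClass c a) i with hf
  -- If some member is empty then all fragments are, so bad pairs arise only over `N`.
  set N : Finset (α → κ) := univ.filter fun c => ∀ i, (S c i).Nonempty with hN
  set V : (α → κ) → Finset α := fun c => minMember (S c) (colourClass c a) with hV
  set B : Finset ((α → κ) × ι) := univ.filter fun p => #(S p.1 p.2) < 4 * #(f p.1 p.2) with hB
  set D : Finset (Σ _ : α → κ, Finset α) :=
    N.sigma fun c => (V c).powerset.filter fun T => #(V c) < 4 * #T with hD
  have hSf : ∀ c i, S (recolour c (f c i) a) = S c :=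
    fun c i => hS c i _ (fragment_subset _ _ _)
  -- Encode a bad pair by the colouring with the fragment added to class `a`, together with the
  -- fragment. The fragment is then a large subset of a set read off from that colouring.
  have hmaps : ∀ p ∈ B, (⟨recolour p.1 (f p.1 p.2) a, f p.1 p.2⟩ : Σ _ : α → κ, Finset α) ∈ D := by
    rintro ⟨c, i⟩ hp
    simp only [hB, mem_filter, mem_univ, true_and] at hp
    have hVc : V (recolour c (f c i) a) = minMember (S c) (colourClass c a ∪ f c i) := by
      simp only [hV]
      rw [hSf, colourClass_recolour]
    obtain ⟨h1, h2⟩ := fragment_subset_minMember (S c) (colourClass c a) i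
    simp only [hD, mem_sigma, mem_filter, mem_powerset, hVc]
    refine ⟨?_, h1, lt_of_le_of_lt h2 hp⟩
    simp only [hN, mem_filter, mem_univ, true_and, hSf]
    intro j
    rw [nonempty_iff_ne_empty]
    intro hj
    have : f c i = ∅ := fragment_eq_empty _ _ _ j hj
    simp [this] at hp
  have hbad : ∑ p ∈ B, (#(f p.1 p.2) : ℝ) ≤ ∑ c ∈ N, (Fintype.card ι : ℝ) * (1 / 4) := by
    rw [← Finset.sum_fiberwise_of_maps_to hmaps, hD, Finset.sum_sigma]
    refine Finset.sum_le_sum fun c' _ => ?_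
    set x : ℝ := Fintype.card κ / r with hx
    have hx0 : 0 ≤ x := by positivity
    have hx1 : x ≤ 1 / 64 := by rw [hx, div_le_iff₀ hr]; linarith
    refine le_trans (Finset.sum_le_sum
      (g := fun T => (Fintype.card ι : ℝ) * ((#T : ℝ) * x ^ #T)) fun T _ => ?_) ?_
    -- Given the code `(c', T)`, at most `|κ| ^ #T` colourings are possible, and spreadness bounds
    -- the indices `i` with `T ⊆ S c' i`.
    · have hsub : (B.filter fun p => (⟨recolour p.1 (f p.1 p.2) a, f p.1 p.2⟩ :
          Σ _ : α → κ, Finset α) = ⟨c', T⟩) ⊆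
          (univ.filter fun c : α → κ => recolour c T a = c') ×ˢ
            (univ.filter fun i => T ⊆ S c' i) := by
        rintro ⟨c, i⟩ hp
        simp only [mem_filter, Sigma.mk.injEq, heq_eq_eq] at hp
        obtain ⟨_, h1, h2⟩ := hp
        subst h2
        simp only [mem_product, mem_filter, mem_univ, true_and]
        refine ⟨h1, ?_⟩
        rw [← h1, hSf]
        exact fragment_subset _ _ _
      have hcard := (card_le_card hsub).trans_eq (card_product _ _)
      have hconst : ∀ p ∈ (B.filter fun p => (⟨recolour p.1 (f p.1 p.2) a, f p.1 p.2⟩ :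
          Σ _ : α → κ, Finset α) = ⟨c', T⟩), (#(f p.1 p.2) : ℝ) = #T := by
        rintro ⟨c, i⟩ hp
        simp only [mem_filter, Sigma.mk.injEq, heq_eq_eq] at hp
        rw [hp.2.2]
      rw [Finset.sum_congr rfl hconst, sum_const, nsmul_eq_mul]
      have h1 : (#(univ.filter fun c : α → κ => recolour c T a = c') : ℝ) ≤
          (Fintype.card κ : ℝ) ^ #T := by exact_mod_cast card_recolour_fiber_le c' T a
      have h2 : (#(univ.filter fun i => T ⊆ S c' i) : ℝ) ≤ Fintype.card ι / r ^ #T := by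
        rw [le_div_iff₀ (by positivity)]; exact hspread c' T
      calc _ ≤ ((#(univ.filter fun c : α → κ => recolour c T a = c') : ℝ) *
            #(univ.filter fun i => T ⊆ S c' i)) * #T := by
            gcongr; exact_mod_cast hcard
        _ ≤ ((Fintype.card κ : ℝ) ^ #T * (Fintype.card ι / r ^ #T)) * #T := by gcongr
        _ = _ := by rw [hx, div_pow]; ring
    · rw [← Finset.mul_sum]
      gcongr
      exact sum_large_subsets_le _ hx0 hx1
  have hN' : ∑ c ∈ N, (Fintype.card ι : ℝ) * (1 / 4) ≤ 1 / 4 * ∑ c, ∑ i, (#(S c i) : ℝ) := by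
    rw [Finset.mul_sum]
    refine le_trans (Finset.sum_le_sum fun c hc => ?_) (Finset.sum_le_univ_sum_of_nonneg
      (f := fun c => 1 / 4 * ∑ i, (#(S c i) : ℝ))
      fun c => mul_nonneg (by norm_num) (Finset.sum_nonneg fun i _ => Nat.cast_nonneg _))
    have h := card_le_sum_card (S c) (mem_filter.1 hc).2
    linarith
  -- A fragment outside `B` has at most a quarter of the size of its member; the bad pairs cost
  -- another quarter of the total.
  have hsplit : ∑ c, ∑ i, (#(f c i) : ℝ) ≤
      1 / 4 * ∑ c, ∑ i, (#(S c i) : ℝ) + ∑ p ∈ B, (#(f p.1 p.2) : ℝ) := by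
    rw [hB, Finset.sum_filter, Fintype.sum_prod_type, Finset.mul_sum, ← Finset.sum_add_distrib]
    refine Finset.sum_le_sum fun c _ => ?_
    rw [Finset.mul_sum, ← Finset.sum_add_distrib]
    refine Finset.sum_le_sum fun i _ => ?_
    split_ifs with h
    · have : (0 : ℝ) ≤ #(S c i) := Nat.cast_nonneg _
      simp only
      linarith
    · have : (4 * #(f c i) : ℝ) ≤ #(S c i) := by exact_mod_cast not_lt.1 h
      linarith
  linarith

/-- The fragments after sampling the colour classes `col 0, …, col (l - 1)` one after another. -/
noncomputable def run (S : ι → Finset α) (col : ℕ → κ) (c : α → κ) : ℕ → ι → Finset α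
  | 0 => S
  | l + 1 => fragment (run S col c l) (colourClass c (col l))

theorem run_subset (S : ι → Finset α) (col : ℕ → κ) (c : α → κ) (l : ℕ) (i : ι) :
    run S col c l i ⊆ S i := by
  induction l with
  | zero => exact Subset.rfl
  | succ l ih => exact (fragment_subset _ _ _).trans ih

theorem disjoint_run (S : ι → Finset α) (col : ℕ → κ) (c : α → κ) (l : ℕ) (i : ι) :
    ∀ l' < l, Disjoint (run S col c l i) (colourClass c (col l')) := by
  induction l with
  | zero => simp
  | succ l ih =>
    intro l' hl'
    rcases Nat.lt_succ_iff_lt_or_eq.1 hl' with h | rfl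
    · exact (ih l' h).mono_left (fragment_subset _ _ _)
    · exact disjoint_fragment _ _ _

/-- This supplies the invariance under recolouring that `sum_card_fragment_le` requires. -/
theorem run_congr (S : ι → Finset α) (col : ℕ → κ) (c c' : α → κ) (l : ℕ)
    (h : ∀ l' < l, colourClass c (col l') = colourClass c' (col l')) :
    run S col c l = run S col c' l := by
  induction l with
  | zero => rfl
  | succ l ih =>
    simp only [run]
    rw [ih fun l' hl' => h l' (hl'.trans l.lt_succ_self), h l l.lt_succ_self]

theorem exists_subset_run_union (S : ι → Finset α) (col : ℕ → κ) (c : α → κ) (l : ℕ) (i : ι) :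
    ∃ j, ∀ x ∈ S j, x ∈ run S col c l i ∨ ∃ l' < l, c x = col l' := by
  induction l generalizing i with
  | zero => exact ⟨i, fun x hx => Or.inl hx⟩
  | succ l ih =>
    obtain ⟨j, hj, _⟩ := exists_subset_fragment_union (run S col c l) (colourClass c (col l)) i
    obtain ⟨j', hj'⟩ := ih j
    refine ⟨j', fun x hx => ?_⟩
    rcases hj' x hx with h | ⟨l', hl', h⟩
    · rcases mem_union.1 (hj h) with h | h
      · exact Or.inl h
      · exact Or.inr ⟨l, l.lt_succ_self, by simpa [mem_colourClass] using h⟩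
    · exact Or.inr ⟨l', hl'.trans l.lt_succ_self, h⟩

theorem sum_card_run_le (S : ι → Finset α) (col : ℕ → κ) {m : ℕ}
    (hcol : ∀ l < m, ∀ l' < l, col l ≠ col l') {r : ℝ} (hr : 0 < r)
    (hM : 64 * (Fintype.card κ : ℝ) ≤ r)
    (hspread : ∀ T, (#(univ.filter fun i => T ⊆ S i) : ℝ) * r ^ #T ≤ Fintype.card ι) :
    ∀ l ≤ m, 2 ^ l * ∑ c, ∑ i, (#(run S col c l i) : ℝ) ≤
      (Fintype.card κ : ℝ) ^ Fintype.card α * ∑ i, (#(S i) : ℝ) := by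
  intro l
  induction l with
  | zero => intro _; simp [run]
  | succ l ih =>
    intro hl
    have step := sum_card_fragment_le (fun c => run S col c l) (col l) hr hM ?_ ?_
    · have ih' := ih (by omega)
      have : (2 : ℝ) ^ (l + 1) * ∑ c, ∑ i, (#(run S col c (l + 1) i) : ℝ) ≤
          2 ^ (l + 1) * (1 / 2 * ∑ c, ∑ i, (#(run S col c l i) : ℝ)) := by
        gcongr; exact step
      refine this.trans (le_trans (le_of_eq ?_) ih')
      rw [pow_succ]; ring
    -- Points of `T` avoid the colours already sampled and the new colour differs from these, so
    -- recolouring changes no earlier class.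
    · intro c i T hT
      refine run_congr S col _ _ l fun l' hl' => ?_
      ext x
      have hd := disjoint_run S col c l i l' hl'
      by_cases hx : x ∈ T
      · have h1 : c x ≠ col l' := by
          intro h
          exact (Finset.disjoint_left.1 hd (hT hx)) (by simpa [mem_colourClass] using h)
        simp [mem_colourClass, recolour, hx, h1, hcol l (by omega) l' hl']
      · simp [mem_colourClass, recolour, hx]
    · intro c T
      refine le_trans ?_ (hspread T)
      gcongr
      exact run_subset _ _ _ _ _

/-- The spread lemma: a random union of `m` colour classes contains a member of a spread family
with high probability. -/
theorem card_bad_colourings_le [Nonempty ι] (S : ι → Finset α) (col : ℕ → κ) {m k : ℕ}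
    (hcol : ∀ l < m, ∀ l' < l, col l ≠ col l') {r : ℝ} (hr : 0 < r)
    (hM : 64 * (Fintype.card κ : ℝ) ≤ r) (hk : ∀ i, #(S i) ≤ k)
    (hspread : ∀ T, (#(univ.filter fun i => T ⊆ S i) : ℝ) * r ^ #T ≤ Fintype.card ι) :
    #(univ.filter fun c : α → κ => ¬ ∃ i, ∀ x ∈ S i, ∃ l < m, c x = col l) * 2 ^ m ≤
      k * Fintype.card κ ^ Fintype.card α := by
  classical
  set B := univ.filter fun c : α → κ => ¬ ∃ i, ∀ x ∈ S i, ∃ l < m, c x = col l with hB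
  have h1 := sum_card_run_le S col hcol hr hM hspread m le_rfl
  -- In a bad colouring no final fragment is empty, so each index contributes at least 1.
  have h2 : (#B : ℝ) * Fintype.card ι ≤ ∑ c, ∑ i, (#(run S col c m i) : ℝ) := by
    rw [← nsmul_eq_mul, ← Finset.sum_const]
    refine le_trans (Finset.sum_le_sum fun c hc => ?_) (Finset.sum_le_univ_sum_of_nonneg
      (f := fun c => ∑ i, (#(run S col c m i) : ℝ))
      fun c => Finset.sum_nonneg fun i _ => Nat.cast_nonneg _)
    refine card_le_sum_card (run S col c m) fun i => ?_
    rw [nonempty_iff_ne_empty]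
    intro he
    obtain ⟨j, hj⟩ := exists_subset_run_union S col c m i
    simp only [hB, mem_filter, mem_univ, true_and] at hc
    exact hc ⟨j, fun x hx => by simpa [he] using hj x hx⟩
  have h3 : ∑ i, (#(S i) : ℝ) ≤ Fintype.card ι * k := by
    have : ∑ i, (#(S i) : ℝ) ≤ ∑ _i : ι, (k : ℝ) :=
      Finset.sum_le_sum fun i _ => by exact_mod_cast hk i
    simpa using this
  have hι : (0 : ℝ) < Fintype.card ι := by exact_mod_cast Fintype.card_pos
  have h4 : ((#B : ℝ) * 2 ^ m) * Fintype.card ι ≤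
      (k * (Fintype.card κ : ℝ) ^ Fintype.card α) * Fintype.card ι := by
    calc ((#B : ℝ) * 2 ^ m) * Fintype.card ι = 2 ^ m * ((#B : ℝ) * Fintype.card ι) := by ring
      _ ≤ 2 ^ m * ∑ c, ∑ i, (#(run S col c m i) : ℝ) := by gcongr
      _ ≤ (Fintype.card κ : ℝ) ^ Fintype.card α * ∑ i, (#(S i) : ℝ) := h1
      _ ≤ (Fintype.card κ : ℝ) ^ Fintype.card α * (Fintype.card ι * k) := by gcongr
      _ = _ := by ring
  exact_mod_cast le_of_mul_le_mul_right h4 hι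

end Round

/-! ### Disjoint members of spread families -/

section Disjoint

variable {α : Type*} [Fintype α] [DecidableEq α]

/-- The family `G`, all of whose members are meant to contain `X`, is `r`-spread over `X`. -/
def SpreadOver (r : ℝ) (X : Finset α) (G : Finset (Finset α)) : Prop :=
  ∀ Z, X ⊆ Z → (#(G.filter fun A => Z ⊆ A) : ℝ) * r ^ #Z ≤ #G * r ^ #X

theorem SpreadOver.sdiff {r : ℝ} (hr : 0 < r) {X : Finset α} {G : Finset (Finset α)}
    (hsub : ∀ A ∈ G, X ⊆ A) (h : SpreadOver r X G) (T : Finset α) :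
    (#(univ.filter fun A : G => T ⊆ (A : Finset α) \ X) : ℝ) * r ^ #T ≤ Fintype.card G := by
  classical
  by_cases hd : Disjoint T X
  · have hcard : #(univ.filter fun A : G => T ⊆ (A : Finset α) \ X) ≤
        #(G.filter fun A => X ∪ T ⊆ A) := by
      refine Finset.card_le_card_of_injOn (fun A => (A : Finset α)) ?_
        (Subtype.val_injective.injOn)
      intro A hA
      have hA' : T ⊆ (A : Finset α) \ X := by simpa using hA
      have : X ∪ T ⊆ (A : Finset α) :=
        union_subset (hsub _ A.2) (hA'.trans sdiff_subset)
      exact mem_coe.2 (mem_filter.2 ⟨A.2, this⟩)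
    have h1 := h (X ∪ T) subset_union_left
    rw [card_union_of_disjoint hd.symm, pow_add] at h1
    have h2 : (#(G.filter fun A => X ∪ T ⊆ A) : ℝ) * r ^ #T ≤ #G := by
      have hX : 0 < r ^ #X := by positivity
      refine le_of_mul_le_mul_right ?_ hX
      linarith
    rw [Fintype.card_coe]
    refine le_trans ?_ h2
    gcongr
  · have : (univ.filter fun A : G => T ⊆ (A : Finset α) \ X) = ∅ := by
      refine filter_eq_empty_iff.2 fun A _ hT => hd ?_
      exact disjoint_of_subset_left hT sdiff_disjoint
    rw [this]
    simp

/-- Members of spread families `G j` whose new parts are pairwise disjoint. -/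
theorem exists_disjoint_sdiff {s m k : ℕ} (hm : 0 < m) (X : Fin s → Finset α)
    (G : Fin s → Finset (Finset α)) {r : ℝ} (hr : 0 < r) (hM : 64 * ((s : ℝ) * m) ≤ r)
    (hk : k * s < 2 ^ m) (hne : ∀ j, (G j).Nonempty) (hsub : ∀ j, ∀ A ∈ G j, X j ⊆ A)
    (hcard : ∀ j, ∀ A ∈ G j, #A ≤ k) (hspread : ∀ j, SpreadOver r (X j) (G j)) :
    ∃ A : Fin s → Finset α, (∀ j, A j ∈ G j) ∧
      ∀ i j, i ≠ j → Disjoint (A i \ X i) (A j \ X j) := by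
  classical
  rcases Nat.eq_zero_or_pos s with rfl | hs
  · exact ⟨fun _ => ∅, fun j => j.elim0, fun j => j.elim0⟩
  set κ := Fin s × Fin m
  -- Each petal owns a block of `m` colours; the reduction mod `m` only makes `col` total.
  set col : Fin s → ℕ → κ := fun j l => (j, ⟨l % m, Nat.mod_lt _ hm⟩) with hcol
  have hκ : Fintype.card κ = s * m := by simp [κ]
  have hinj : ∀ j, ∀ l < m, ∀ l' < l, col j l ≠ col j l' := by
    intro j l hl l' hl' h
    replace h : l % m = l' % m := congrArg (fun p => p.2.val) h
    rw [Nat.mod_eq_of_lt hl, Nat.mod_eq_of_lt (hl'.trans hl)] at h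
    omega
  set B : Fin s → Finset (α → κ) := fun j => univ.filter fun c : α → κ =>
    ¬ ∃ A : G j, ∀ x ∈ (A : Finset α) \ X j, ∃ l < m, c x = col j l with hB
  have hbad : ∀ j, #(B j) * 2 ^ m ≤ k * Fintype.card κ ^ Fintype.card α := by
    intro j
    have : Nonempty (G j) := (hne j).coe_sort
    refine card_bad_colourings_le (fun A : G j => (A : Finset α) \ X j) (col j) (hinj j) hr
      (by rw [hκ]; exact_mod_cast hM) (fun A => (card_le_card sdiff_subset).trans (hcard j _ A.2))
      (fun T => (hspread j).sdiff hr (hsub j) T)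
  -- Union bound: the bad fractions add up to at most `k * s / 2 ^ m < 1`.
  have hgood : ∃ c : α → κ, ∀ j, c ∉ B j := by
    by_contra! hcon
    have h1 : Fintype.card κ ^ Fintype.card α ≤ ∑ j, #(B j) := by
      rw [← Fintype.card_fun, ← Finset.card_univ]
      refine le_trans (card_le_card fun c _ => ?_) Finset.card_biUnion_le
      obtain ⟨j, hj⟩ := hcon c
      exact mem_biUnion.2 ⟨j, mem_univ _, hj⟩
    have h2 : (∑ j, #(B j)) * 2 ^ m ≤ (k * s) * Fintype.card κ ^ Fintype.card α := by
      rw [Finset.sum_mul]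
      refine (Finset.sum_le_sum fun j _ => hbad j).trans (le_of_eq ?_)
      rw [sum_const, card_univ, Fintype.card_fin, smul_eq_mul]; ring
    have h3 : 0 < Fintype.card κ ^ Fintype.card α := by
      rw [hκ]; positivity
    have h4 := Nat.mul_le_mul_right (2 ^ m) h1
    have h5 := Nat.mul_lt_mul_of_pos_right hk h3
    nlinarith
  obtain ⟨c, hc⟩ := hgood
  simp only [hB, mem_filter, mem_univ, true_and, not_not] at hc
  choose A hA using hc
  refine ⟨fun j => A j, fun j => (A j).2, fun i j hij => ?_⟩
  rw [Finset.disjoint_left]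
  intro x hx hx'
  obtain ⟨l, _, hl⟩ := hA i x hx
  obtain ⟨l', _, hl'⟩ := hA j x hx'
  exact hij (congrArg Prod.fst (hl.symm.trans hl'))

/-- A spread family has `s` members with pairwise disjoint new parts. -/
theorem exists_disjoint_sdiff_of_single {m k : ℕ} (s : ℕ) (hs : 0 < s) (hm : 0 < m)
    (X : Finset α) (G : Finset (Finset α)) {r : ℝ} (hr : 0 < r) (hM : 128 * ((s : ℝ) * m) ≤ r)
    (hk : 2 * k ≤ 2 ^ m) (hne : G.Nonempty) (hsub : ∀ A ∈ G, X ⊆ A)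
    (hcard : ∀ A ∈ G, #A ≤ k) (hspread : SpreadOver r X G) :
    ∃ A : Fin s → Finset α, (∀ j, A j ∈ G) ∧
      ∀ i j, i ≠ j → Disjoint (A i \ X) (A j \ X) := by
  classical
  -- With `2 * s` blocks, each failing for at most half of the colourings, averaging gives a
  -- colouring with `s` good blocks. Thus `m` need not grow with `s`, which is what leaves `log t`
  -- in the final bound.
  set κ := Fin (2 * s) × Fin m
  set col : Fin (2 * s) → ℕ → κ := fun j l => (j, ⟨l % m, Nat.mod_lt _ hm⟩) with hcol
  have hκ : Fintype.card κ = 2 * s * m := by simp [κ]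
  have hinj : ∀ j, ∀ l < m, ∀ l' < l, col j l ≠ col j l' := by
    intro j l hl l' hl' h
    replace h : l % m = l' % m := congrArg (fun p => p.2.val) h
    rw [Nat.mod_eq_of_lt hl, Nat.mod_eq_of_lt (hl'.trans hl)] at h
    omega
  have : Nonempty G := hne.coe_sort
  set P : Fin (2 * s) → (α → κ) → Prop := fun j c =>
    ∃ A : G, ∀ x ∈ (A : Finset α) \ X, ∃ l < m, c x = col j l with hP
  have hbad : ∀ j, #(univ.filter fun c => ¬ P j c) * 2 ^ m ≤
      k * Fintype.card κ ^ Fintype.card α := by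
    intro j
    refine card_bad_colourings_le (fun A : G => (A : Finset α) \ X) (col j) (hinj j) hr
      (by rw [hκ]; push_cast; linarith) (fun A => (card_le_card sdiff_subset).trans (hcard _ A.2))
      (fun T => hspread.sdiff hr hsub T)
  have : Nonempty κ := ⟨(⟨0, by omega⟩, ⟨0, hm⟩)⟩
  have hgood : ∃ c : α → κ, s ≤ #(univ.filter fun j => P j c) := by
    by_contra! hcon
    have h1 : ∑ c : α → κ, #(univ.filter fun j => ¬ P j c) =
        ∑ j, #(univ.filter fun c => ¬ P j c) := by
      simp only [Finset.card_filter]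
      exact Finset.sum_comm
    have h2 : (∑ j, #(univ.filter fun c => ¬ P j c)) * 2 ^ m ≤
        s * 2 ^ m * Fintype.card κ ^ Fintype.card α := by
      rw [Finset.sum_mul]
      refine (Finset.sum_le_sum fun j _ => hbad j).trans ?_
      rw [sum_const, card_univ, Fintype.card_fin, smul_eq_mul]
      calc 2 * s * (k * Fintype.card κ ^ Fintype.card α)
          = s * (2 * k) * Fintype.card κ ^ Fintype.card α := by ring
        _ ≤ _ := by gcongr
    have h3 : ∑ _c : α → κ, s < ∑ c : α → κ, #(univ.filter fun j => ¬ P j c) := by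
      refine Finset.sum_lt_sum_of_nonempty univ_nonempty fun c _ => ?_
      have h4 := Finset.card_filter_add_card_filter_not
        (s := (univ : Finset (Fin (2 * s)))) (fun j => P j c)
      rw [card_univ, Fintype.card_fin] at h4
      have := hcon c
      omega
    rw [h1, sum_const, card_univ, Fintype.card_fun, smul_eq_mul] at h3
    have h5 := Nat.mul_lt_mul_of_pos_right h3 (show 0 < 2 ^ m by positivity)
    nlinarith
  obtain ⟨c, hc⟩ := hgood
  set e := (univ.filter fun j => P j c).orderEmbOfCardLe hc
  have he : ∀ j, P (e j) c := fun j =>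
    (mem_filter.1 (Finset.orderEmbOfCardLe_mem (univ.filter fun j => P j c) hc j)).2
  choose A hA using he
  refine ⟨fun j => A j, fun j => (A j).2, fun i j hij => ?_⟩
  rw [Finset.disjoint_left]
  intro x hx hx'
  obtain ⟨l, _, hl⟩ := hA i x hx
  obtain ⟨l', _, hl'⟩ := hA j x hx'
  exact hij (e.injective (congrArg Prod.fst (hl.symm.trans hl')))

end Disjoint

/-! ### Lifting sunflowers through spread families -/

section Sunflower

variable {α : Type*} [Fintype α] [DecidableEq α]

/-- The sets `A 0, …, A (s - 1)` form a sunflower with core `C`. -/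
def IsFlower {s : ℕ} (A : Fin s → Finset α) (C : Finset α) : Prop :=
  (∀ j, C ⊆ A j) ∧ ∀ i j, i ≠ j → A i ∩ A j ⊆ C

theorem IsFlower.of_disjoint_sdiff {s : ℕ} {A : Fin s → Finset α} {X : Fin s → Finset α}
    {C : Finset α} (hX : IsFlower X C) (hXA : ∀ j, X j ⊆ A j)
    (hd : ∀ i j, i ≠ j → Disjoint (A i \ X i) (A j \ X j))
    (hA : ∀ i j, A i ∩ X j ⊆ X i) : IsFlower A C := by
  refine ⟨fun j => (hX.1 j).trans (hXA j), fun i j hij x hx => ?_⟩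
  rw [mem_inter] at hx
  by_cases hi : x ∈ X i
  · exact hX.2 i j hij (mem_inter.2 ⟨hi, hA j i (mem_inter.2 ⟨hx.2, hi⟩)⟩)
  · by_cases hj : x ∈ X j
    · exact absurd (hA i j (mem_inter.2 ⟨hx.1, hj⟩)) hi
    · exact absurd (mem_sdiff.2 ⟨hx.2, hj⟩)
        (Finset.disjoint_left.1 (hd i j hij) (mem_sdiff.2 ⟨hx.1, hi⟩))

/-- Each point of `V \ X` lies in at most a `1 / r` fraction of `G`, so at least half of `G`
survives. The lost factor 2 matters only for `Z ≠ X`, where halving the rate absorbs it. -/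
theorem SpreadOver.avoid {r : ℝ} (hr : 0 < r) {X V : Finset α} {G : Finset (Finset α)}
    (hne : G.Nonempty) (hsub : ∀ A ∈ G, X ⊆ A) (h : SpreadOver r X G) (hV : 2 * (#V : ℝ) ≤ r) :
    (G.filter fun A => A ∩ V ⊆ X).Nonempty ∧
      SpreadOver (r / 2) X (G.filter fun A => A ∩ V ⊆ X) := by
  classical
  set H := G.filter fun A => A ∩ V ⊆ X with hH
  have hG : (0 : ℝ) < #G := by exact_mod_cast hne.card_pos
  have hpt : ∀ v ∈ V \ X, (#(G.filter fun A => insert v X ⊆ A) : ℝ) ≤ #G / r := by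
    intro v hv
    have hvX := (mem_sdiff.1 hv).2
    have h1 := h (insert v X) (subset_insert _ _)
    rw [card_insert_of_notMem hvX, pow_succ] at h1
    have hX : 0 < r ^ #X := by positivity
    rw [le_div_iff₀ hr]
    refine le_of_mul_le_mul_right ?_ hX
    linarith
  have hbad : (#(G.filter fun A => ¬ A ∩ V ⊆ X) : ℝ) ≤ #G / 2 := by
    have hsub' : (G.filter fun A => ¬ A ∩ V ⊆ X) ⊆
        (V \ X).biUnion fun v => G.filter fun A => insert v X ⊆ A := by
      intro A hA
      rw [mem_filter, not_subset] at hA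
      obtain ⟨hAG, v, hv, hvX⟩ := hA
      rw [mem_inter] at hv
      exact mem_biUnion.2 ⟨v, mem_sdiff.2 ⟨hv.2, hvX⟩,
        mem_filter.2 ⟨hAG, insert_subset hv.1 (hsub A hAG)⟩⟩
    have h1 := (card_le_card hsub').trans card_biUnion_le
    have h2 : (#(G.filter fun A => ¬ A ∩ V ⊆ X) : ℝ) ≤
        ∑ v ∈ V \ X, (#(G.filter fun A => insert v X ⊆ A) : ℝ) := by exact_mod_cast h1
    refine h2.trans ((Finset.sum_le_sum hpt).trans ?_)
    rw [sum_const, nsmul_eq_mul]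
    have h3 : (#(V \ X) : ℝ) ≤ #V := by exact_mod_cast card_le_card sdiff_subset
    calc (#(V \ X) : ℝ) * (#G / r) ≤ (r / 2) * (#G / r) := by gcongr; linarith
      _ = #G / 2 := by field_simp
  have hadd := Finset.card_filter_add_card_filter_not (s := G) (fun A => A ∩ V ⊆ X)
  have hadd' : (#H : ℝ) + #(G.filter fun A => ¬ A ∩ V ⊆ X) = #G := by exact_mod_cast hadd
  have hhalf : (#G : ℝ) ≤ 2 * #H := by linarith
  have hHpos : (0 : ℝ) < #H := by linarith
  refine ⟨card_pos.1 (by exact_mod_cast hHpos), fun Z hZ => ?_⟩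
  rcases eq_or_ne Z X with rfl | hne'
  · gcongr
    exact filter_subset _ _
  · have hlt : #X + 1 ≤ #Z := card_lt_card (lt_of_le_of_ne hZ hne'.symm)
    have h1 : (#(H.filter fun A => Z ⊆ A) : ℝ) ≤ #(G.filter fun A => Z ⊆ A) := by
      gcongr
      exact filter_subset _ _
    have h2 := h Z hZ
    rw [div_pow, div_pow]
    have h3 : (#(H.filter fun A => Z ⊆ A) : ℝ) * r ^ #Z ≤ 2 * #H * r ^ #X := by
      calc _ ≤ (#(G.filter fun A => Z ⊆ A) : ℝ) * r ^ #Z := by gcongr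
        _ ≤ #G * r ^ #X := h2
        _ ≤ _ := by gcongr
    have h4 : (2 : ℝ) ^ (#X + 1) ≤ 2 ^ #Z := pow_le_pow_right₀ (by norm_num) hlt
    calc (#(H.filter fun A => Z ⊆ A) : ℝ) * (r ^ #Z / 2 ^ #Z)
        = (#(H.filter fun A => Z ⊆ A) : ℝ) * r ^ #Z / 2 ^ #Z := by ring
      _ ≤ 2 * #H * r ^ #X / 2 ^ (#X + 1) := by gcongr
      _ = #H * (r ^ #X / 2 ^ #X) := by rw [pow_succ]; field_simp

/-- Replacing the petals of a sunflower by members of families that are spread over them. -/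
theorem IsFlower.exists_replacement {s m k q : ℕ} (hm : 0 < m) {X : Fin s → Finset α}
    {C : Finset α} (hX : IsFlower X C) (G : Fin s → Finset (Finset α)) {r : ℝ} (hr : 0 < r)
    (hq : 2 * ((s : ℝ) * q) ≤ r) (hM : 128 * ((s : ℝ) * m) ≤ r) (hk : k * s < 2 ^ m)
    (hXq : ∀ j, #(X j) ≤ q) (hne : ∀ j, (G j).Nonempty) (hsub : ∀ j, ∀ A ∈ G j, X j ⊆ A)
    (hcard : ∀ j, ∀ A ∈ G j, #A ≤ k) (hspread : ∀ j, SpreadOver r (X j) (G j)) :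
    ∃ A : Fin s → Finset α, (∀ j, A j ∈ G j) ∧ IsFlower A C := by
  classical
  -- Avoiding all old petals keeps the new parts from meeting them. The rate is halved, whence 128
  -- in place of 64.
  set V : Finset α := univ.biUnion X with hVdef
  have hV : 2 * (#V : ℝ) ≤ r := by
    have h1 : #V ≤ s * q := by
      refine card_biUnion_le.trans ((Finset.sum_le_sum fun j _ => hXq j).trans ?_)
      simp
    have h2 : (#V : ℝ) ≤ s * q := by exact_mod_cast h1
    linarith
  have hav := fun j => (hspread j).avoid hr (hne j) (hsub j) hV
  obtain ⟨A, hA, hd⟩ := exists_disjoint_sdiff hm X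
    (fun j => (G j).filter fun A => A ∩ V ⊆ X j) (half_pos hr) (by linarith) hk
    (fun j => (hav j).1) (fun j A hA => hsub j A (mem_filter.1 hA).1)
    (fun j A hA => hcard j A (mem_filter.1 hA).1) (fun j => (hav j).2)
  refine ⟨A, fun j => (mem_filter.1 (hA j)).1, hX.of_disjoint_sdiff
    (fun j => hsub j _ (mem_filter.1 (hA j)).1) hd fun i j => ?_⟩
  exact (inter_subset_inter_left (subset_biUnion_of_mem X (mem_univ j))).trans
    (mem_filter.1 (hA i)).2

/-- Let `Y ⊇ X` maximise the number of members containing it times `r ^ #Y`; maximality is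
spreadness over `Y`. -/
theorem exists_maximal_spread (G : Finset (Finset α)) (r : ℝ) (X : Finset α) :
    ∃ Y, X ⊆ Y ∧ (#(G.filter fun A => X ⊆ A) : ℝ) * r ^ #X ≤ #(G.filter fun A => Y ⊆ A) * r ^ #Y ∧
      SpreadOver r Y (G.filter fun A => Y ⊆ A) := by
  classical
  obtain ⟨Y, hY, hmax⟩ := Finset.exists_max_image (univ.filter fun Y => X ⊆ Y)
    (fun Y => (#(G.filter fun A => Y ⊆ A) : ℝ) * r ^ #Y) ⟨X, by simp⟩
  simp only [mem_filter, mem_univ, true_and] at hY hmax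
  refine ⟨Y, hY, hmax X Subset.rfl, fun Z hZ => ?_⟩
  have : ((G.filter fun A => Y ⊆ A).filter fun A => Z ⊆ A) = G.filter fun A => Z ⊆ A := by
    ext A
    simp only [mem_filter, and_assoc, and_congr_right_iff, and_iff_right_iff_imp]
    exact fun _ h => hZ.trans h
  rw [this]
  exact hmax Z (hY.trans hZ)

/-- This lets a petal stay unchanged in a replacement. -/
theorem spreadOver_singleton {r : ℝ} (hr : 0 ≤ r) (X : Finset α) :
    SpreadOver r X {X} := by
  classical
  intro Z hZ
  rcases eq_or_ne Z X with rfl | hne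
  · gcongr
    exact filter_subset _ _
  · have : ({X} : Finset (Finset α)).filter (fun A => Z ⊆ A) = ∅ := by
      rw [filter_eq_empty_iff]
      intro A hA h
      rw [mem_singleton.1 hA] at h
      exact hne (h.antisymm hZ)
    rw [this]
    simp only [card_empty, Nat.cast_zero, zero_mul, card_singleton, Nat.cast_one, one_mul]
    positivity

end Sunflower

/-! ### Spread approximation of a sunflower-free family -/

section Approximation

variable {α : Type*} [Fintype α] [DecidableEq α]

/-- The family `G` has no sunflower with `s` petals and core of size less than `t`. -/
def FlowerFree (s t : ℕ) (G : Finset (Finset α)) : Prop :=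
  ∀ (A : Fin s → Finset α) (C : Finset α), (∀ j, A j ∈ G) → IsFlower A C → t ≤ #C

theorem FlowerFree.mono {s t : ℕ} {G H : Finset (Finset α)} (hH : FlowerFree s t H)
    (h : G ⊆ H) : FlowerFree s t G :=
  fun A C hA hC => hH A C (fun j => h (hA j)) hC

/-- Equal petals are allowed: `s` copies of `A` form a sunflower with core `A`. -/
theorem FlowerFree.le_card {s t : ℕ} {G : Finset (Finset α)} (hG : FlowerFree s t G)
    {A : Finset α} (hA : A ∈ G) : t ≤ #A :=
  hG (fun _ => A) A (fun _ => hA) ⟨fun _ => Subset.rfl, fun _ _ _ => inter_subset_left⟩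

/-- Sets of size at most `q` over which some subfamily of `F` is spread form a sunflower-free
family, and few members of `F` contain none of them. -/
theorem exists_spread_cover {n s t q m : ℕ} (hm : 0 < m) (F : Finset (Finset α))
    (hFcard : ∀ B ∈ F, #B ≤ n) (hF : FlowerFree s t F) {r : ℝ} (hr : 0 < r)
    (hq : 2 * ((s : ℝ) * q) ≤ r) (hM : 128 * ((s : ℝ) * m) ≤ r) (hk : n * s < 2 ^ m) :
    ∃ H : Finset (Finset α), (∀ X ∈ H, #X ≤ q ∧ ∃ B ∈ F, X ⊆ B) ∧ FlowerFree s t H ∧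
      (F.filter (fun B => ∀ X ∈ H, ¬ X ⊆ B) = ∅ ∨ ∃ Y : Finset α, q < #Y ∧
        (#(F.filter fun B => ∀ X ∈ H, ¬ X ⊆ B) : ℝ) ≤
          #(F.filter fun B => Y ⊆ B) * r ^ #Y) := by
  classical
  set H : Finset (Finset α) := univ.filter fun X => #X ≤ q ∧ ∃ G ⊆ F, G.Nonempty ∧
    (∀ A ∈ G, X ⊆ A) ∧ SpreadOver r X G with hH
  have hmem : ∀ X, X ∈ H ↔ #X ≤ q ∧ ∃ G ⊆ F, G.Nonempty ∧
      (∀ A ∈ G, X ⊆ A) ∧ SpreadOver r X G := by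
    intro X; rw [hH, mem_filter]; simp
  refine ⟨H, fun X hX => ?_, fun A C hA hC => ?_, ?_⟩
  · obtain ⟨hXq, G, hGF, ⟨B, hB⟩, hsub, _⟩ := (hmem X).1 hX
    exact ⟨hXq, B, hGF hB, hsub B hB⟩
  · choose hAq G hGF hne hsub hspread using fun j => (hmem (A j)).1 (hA j)
    obtain ⟨A', hA', hC'⟩ := hC.exists_replacement hm G hr hq hM hk hAq hne hsub
      (fun j B hB => hFcard B (hGF j hB)) hspread
    exact hF A' C (fun j => hGF j (hA' j)) hC'
  · set F' := F.filter fun B => ∀ X ∈ H, ¬ X ⊆ B with hF'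
    rcases F'.eq_empty_or_nonempty with h | hne
    · exact Or.inl h
    · right
      obtain ⟨Y, _, hY, hspread⟩ := exists_maximal_spread F' r ∅
      simp only [empty_subset, filter_true, card_empty, pow_zero, mul_one] at hY
      refine ⟨Y, ?_, hY.trans ?_⟩
      -- A `Y` of size at most `q` would itself belong to `H`, although members of `F'` contain no
      -- member of `H`.
      · by_contra hYq
        have hpos : (F'.filter fun A => Y ⊆ A).Nonempty := by
          rw [nonempty_iff_ne_empty]
          intro h
          rw [h] at hY
          have : (0 : ℝ) < #F' := by exact_mod_cast hne.card_pos
          simp only [card_empty, Nat.cast_zero, zero_mul] at hY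
          linarith
        have hYH : Y ∈ H := (hmem Y).2 ⟨not_lt.1 hYq, _,
          (filter_subset _ _).trans (filter_subset _ _), hpos,
          fun A hA => (mem_filter.1 hA).2, hspread⟩
        obtain ⟨B, hB⟩ := hpos
        rw [mem_filter, hF', mem_filter] at hB
        exact hB.1.2 Y hYH hB.2
      · gcongr
        exact filter_subset _ _

theorem exists_maximal_flowerFree {s t : ℕ} (Q H : Finset (Finset α)) (hHQ : H ⊆ Q)
    (hH : FlowerFree s t H) :
    ∃ U, H ⊆ U ∧ U ⊆ Q ∧ FlowerFree s t U ∧ ∀ X ∈ Q, FlowerFree s t (insert X U) → X ∈ U := by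
  classical
  obtain ⟨U, hU, hmax⟩ := Finset.exists_max_image
    (Q.powerset.filter fun U => H ⊆ U ∧ FlowerFree s t U) (fun U => #U)
    ⟨H, by simp [hHQ, hH]⟩
  simp only [mem_filter, mem_powerset] at hU hmax
  refine ⟨U, hU.2.1, hU.1, hU.2.2, fun X hX hf => ?_⟩
  by_contra hXU
  have := hmax (insert X U)
    ⟨insert_subset hX hU.1, hU.2.1.trans (subset_insert _ _), hf⟩
  rw [card_insert_of_notMem hXU] at this
  omega

/-- A sunflower using `X` lifts to one inside `U` with the same core: copies of `X` are replaced by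
members of `G`, the other petals stay. Hence adding `X` creates no forbidden sunflower. -/
theorem mem_of_maximal_flowerFree {s t q m : ℕ} (hm : 0 < m) {Q U : Finset (Finset α)}
    (hQ : ∀ X ∈ Q, #X ≤ q) (hUQ : U ⊆ Q) (hU : FlowerFree s t U)
    (hmax : ∀ X ∈ Q, FlowerFree s t (insert X U) → X ∈ U) {r : ℝ} (hr : 0 < r)
    (hq : 2 * ((s : ℝ) * q) ≤ r) (hM : 128 * ((s : ℝ) * m) ≤ r) (hk : q * s < 2 ^ m)
    {X : Finset α} (hX : X ∈ Q) {G : Finset (Finset α)} (hGU : G ⊆ U) (hne : G.Nonempty)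
    (hsub : ∀ A ∈ G, X ⊆ A) (hspread : SpreadOver r X G) : X ∈ U := by
  classical
  refine hmax X hX fun A C hA hC => ?_
  have hAQ : ∀ j, A j ∈ Q := fun j => insert_subset hX hUQ (hA j)
  obtain ⟨A', hA', hC'⟩ := hC.exists_replacement (k := q) hm
    (fun j => if A j = X then G else {A j}) hr hq hM hk (fun j => hQ _ (hAQ j))
    (fun j => by split_ifs <;> simp [hne])
    (fun j B hB => by
      split_ifs at hB with h
      · exact h ▸ hsub B hB
      · exact (mem_singleton.1 hB).symm.subset)
    (fun j B hB => by
      split_ifs at hB with h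
      · exact hQ _ (hUQ (hGU hB))
      · rw [mem_singleton.1 hB]; exact hQ _ (hAQ j))
    (fun j => by
      split_ifs with h
      · rwa [h]
      · exact spreadOver_singleton hr.le _)
  refine hU A' C (fun j => ?_) hC'
  have := hA' j
  split_ifs at this with h
  · exact hGU this
  · rw [mem_singleton.1 this]
    exact (mem_insert.1 (hA j)).resolve_left h

/-- The number of `i`-element minimal members of a maximal sunflower-free family. -/
theorem card_minimal_le {s t q m m' i : ℕ} (hs : 0 < s) (hm : 0 < m) (hm' : 0 < m')
    {Q U : Finset (Finset α)}
    (hQ : ∀ X ∈ Q, #X ≤ q) (hQdown : ∀ X ∈ Q, ∀ Y ⊆ X, Y ∈ Q) (hUQ : U ⊆ Q)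
    (hU : FlowerFree s t U) (hmax : ∀ X ∈ Q, FlowerFree s t (insert X U) → X ∈ U)
    {r r' : ℝ} (hr : 0 < r) (hq : 2 * ((s : ℝ) * q) ≤ r) (hM : 128 * ((s : ℝ) * m) ≤ r)
    (hk : q * s < 2 ^ m) (hr' : 0 < r') (hrr' : r' ≤ r) (hM' : 128 * ((s : ℝ) * m') ≤ r')
    (hi : 2 * i ≤ 2 ^ m') (hti : t ≤ i) {W : Finset (Finset α)}
    (hW : ∀ A ∈ W, A ∈ U ∧ (∀ A' ∈ U, A' ⊆ A → A' = A) ∧ #A = i) :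
    (#W : ℝ) ≤ r' ^ t * r ^ (i - t) := by
  classical
  have hWU : W ⊆ U := fun A hA => (hW A hA).1
  have hle : ∀ Y : Finset α, (W.filter fun A => Y ⊆ A).Nonempty → #Y ≤ i := by
    rintro Y ⟨A, hA⟩
    rw [mem_filter] at hA
    rw [← (hW A hA.1).2.2]
    exact card_le_card hA.2
  -- Otherwise a maximal spread `Y` over `X` lies in `U`; minimality makes `Y` equal to a member of
  -- `W`, and then only one member of `W` contains it, too few for the assumed excess.
  have hlink : ∀ X : Finset α, #X ≤ i → (#(W.filter fun A => X ⊆ A) : ℝ) ≤ r ^ (i - #X) := by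
    intro X hXi
    by_contra! hcon
    obtain ⟨Y, hXY, hY, hspread⟩ := exists_maximal_spread W r X
    have hbig : r ^ i < #(W.filter fun A => Y ⊆ A) * r ^ #Y := by
      refine lt_of_lt_of_le ?_ hY
      calc r ^ i = r ^ (i - #X) * r ^ #X := by rw [← pow_add]; congr 1; omega
        _ < _ := by gcongr
    have hne : (W.filter fun A => Y ⊆ A).Nonempty := by
      rw [nonempty_iff_ne_empty]
      intro h
      rw [h, card_empty, Nat.cast_zero, zero_mul] at hbig
      exact absurd hbig (not_lt.2 (by positivity))
    have hYi := hle Y hne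
    obtain ⟨A, hA⟩ := hne
    have hA' := mem_filter.1 hA
    obtain ⟨hAU, hAmin, hAi⟩ := hW A hA'.1
    have hYU : Y ∈ U := mem_of_maximal_flowerFree hm hQ hUQ hU hmax hr hq hM hk
      (hQdown A (hUQ hAU) Y hA'.2) ((filter_subset _ _).trans hWU) ⟨A, hA⟩
      (fun B hB => (mem_filter.1 hB).2) hspread
    have hYA := hAmin Y hYU hA'.2
    have hsub : (W.filter fun A => Y ⊆ A) ⊆ {A} := by
      intro B hB
      rw [mem_filter] at hB
      rw [mem_singleton]
      refine (eq_of_subset_of_card_le (hYA ▸ hB.2) ?_).symm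
      rw [(hW B hB.1).2.2, hAi]
    have h1 : (#(W.filter fun A => Y ⊆ A) : ℝ) ≤ 1 := by
      exact_mod_cast (card_le_card hsub).trans_eq (card_singleton A)
    rw [hYA, hAi] at hbig
    rw [hYA] at h1
    have : 0 < r ^ i := by positivity
    nlinarith
  rcases W.eq_empty_or_nonempty with rfl | hWne
  · simp only [card_empty, Nat.cast_zero]; positivity
  -- Now at the smaller rate `r'`: if `#Y < t`, members with disjoint new parts form a forbidden
  -- sunflower with core `Y`. So `#Y ≥ t`, and the link bound handles the rest at rate `r`.
  obtain ⟨Y, _, hY, hspread⟩ := exists_maximal_spread W r' ∅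
  simp only [empty_subset, filter_true, card_empty, pow_zero, mul_one] at hY
  have hne : (W.filter fun A => Y ⊆ A).Nonempty := by
    rw [nonempty_iff_ne_empty]
    intro h
    rw [h, card_empty, Nat.cast_zero, zero_mul] at hY
    have : (0 : ℝ) < #W := by exact_mod_cast hWne.card_pos
    linarith
  have hYi := hle Y hne
  rcases lt_or_ge #Y t with hYt | hYt
  · exfalso
    obtain ⟨A, hA, hd⟩ := exists_disjoint_sdiff_of_single s hs hm' Y _ hr' hM' hi hne
      (fun A hA => (mem_filter.1 hA).2)
      (fun A hA => ((hW A (mem_filter.1 hA).1).2.2).le) hspread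
    have hflower : IsFlower A Y := by
      refine ⟨fun j => (mem_filter.1 (hA j)).2, fun i j hij x hx => ?_⟩
      by_contra hxY
      rw [mem_inter] at hx
      exact Finset.disjoint_left.1 (hd i j hij) (mem_sdiff.2 ⟨hx.1, hxY⟩)
        (mem_sdiff.2 ⟨hx.2, hxY⟩)
    have := hU A Y (fun j => hWU (mem_filter.1 (hA j)).1) hflower
    omega
  · calc (#W : ℝ) ≤ #(W.filter fun A => Y ⊆ A) * r' ^ #Y := hY
      _ ≤ r ^ (i - #Y) * r' ^ #Y := by gcongr; exact hlink Y hYi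
      _ = r ^ (i - #Y) * (r' ^ (#Y - t) * r' ^ t) := by rw [← pow_add]; congr 2; omega
      _ ≤ r ^ (i - #Y) * (r ^ (#Y - t) * r' ^ t) := by gcongr
      _ = r' ^ t * (r ^ (i - #Y) * r ^ (#Y - t)) := by ring
      _ = r' ^ t * r ^ (i - t) := by rw [← pow_add]; congr 2; omega

/-- Approximation of a sunflower-free family `F` of `n`-element sets by a sunflower-free family of
`t`-element sets. -/
theorem exists_approximation {n s t q m : ℕ} (hs : 0 < s) (hm : 0 < m) (F : Finset (Finset α))
    (hFcard : ∀ B ∈ F, #B ≤ n) (hF : FlowerFree s t F) {p r : ℝ} {r' : ℕ → ℝ} (hp : 0 < p)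
    (hqp : 2 * ((s : ℝ) * q) ≤ p) (hMp : 128 * ((s : ℝ) * m) ≤ p) (hnm : n * s < 2 ^ m)
    (hr : 0 < r) (hqr : 2 * ((s : ℝ) * q) ≤ r) (hMr : 128 * ((s : ℝ) * m) ≤ r)
    (hqm : q * s < 2 ^ m)
    (hr' : ∀ i, t < i → i ≤ q → 0 < r' i ∧ r' i ≤ r ∧
      ∃ m' : ℕ, 0 < m' ∧ 128 * ((s : ℝ) * m') ≤ r' i ∧ 2 * i ≤ 2 ^ m') :
    ∃ T : Finset (Finset α), (∀ A ∈ T, #A = t ∧ ∃ B ∈ F, A ⊆ B) ∧ FlowerFree s t T ∧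
      ∃ (F' : Finset (Finset α)) (W : ℕ → Finset (Finset α)),
        (F.filter fun B => ∀ A ∈ T, ¬ A ⊆ B) ⊆
          F' ∪ (Ioc t q).biUnion (fun i => (W i).biUnion fun A => F.filter fun B => A ⊆ B) ∧
        (F' = ∅ ∨ ∃ Y : Finset α, q < #Y ∧ (#F' : ℝ) ≤ #(F.filter fun B => Y ⊆ B) * p ^ #Y) ∧
        ∀ i ∈ Ioc t q, (∀ A ∈ W i, #A = i) ∧ (#(W i) : ℝ) ≤ r' i ^ t * r ^ (i - t) := by
  classical
  obtain ⟨H, hHQ, hHfree, hHF⟩ := exists_spread_cover hm F hFcard hF hp hqp hMp hnm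
  set Q : Finset (Finset α) := univ.filter fun X => #X ≤ q ∧ ∃ B ∈ F, X ⊆ B with hQdef
  have hQ : ∀ X, X ∈ Q ↔ #X ≤ q ∧ ∃ B ∈ F, X ⊆ B := by
    intro X; rw [hQdef, mem_filter]; simp
  obtain ⟨U, hHU, hUQ, hU, hmax⟩ := exists_maximal_flowerFree (s := s) (t := t) Q H
    (fun X hX => (hQ X).2 (hHQ X hX)) hHfree
  -- The inclusion-minimal members of `U`, by size; they cover everything that `U` covers.
  set W : ℕ → Finset (Finset α) := fun i =>
    U.filter fun A => (∀ A' ∈ U, A' ⊆ A → A' = A) ∧ #A = i with hW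
  refine ⟨W t, fun A hA => ?_, hU.mono (filter_subset _ _), _, W, ?_, hHF, fun i hi => ⟨?_, ?_⟩⟩
  · rw [hW, mem_filter] at hA
    exact ⟨hA.2.2, ((hQ A).1 (hUQ hA.1)).2⟩
  · intro B hB
    rw [mem_filter] at hB
    by_cases hBH : ∀ X ∈ H, ¬ X ⊆ B
    · exact mem_union_left _ (mem_filter.2 ⟨hB.1, hBH⟩)
    · push Not at hBH
      obtain ⟨X, hXH, hXB⟩ := hBH
      obtain ⟨A, hA, hAmin⟩ := Finset.exists_min_image (U.filter fun A => A ⊆ X) (fun A => #A)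
        ⟨X, mem_filter.2 ⟨hHU hXH, Subset.rfl⟩⟩
      rw [mem_filter] at hA
      have hAW : A ∈ W #A := by
        rw [hW, mem_filter]
        refine ⟨hA.1, fun A' hA' hsub => ?_, rfl⟩
        exact eq_of_subset_of_card_le hsub
          (hAmin A' (mem_filter.2 ⟨hA', hsub.trans hA.2⟩))
      have hAt := hU.le_card hA.1
      have hAt' : #A ≠ t := fun h => hB.2 A (h ▸ hAW) (hA.2.trans hXB)
      refine mem_union_right _ (mem_biUnion.2 ⟨#A, mem_Ioc.2 ⟨by omega, ?_⟩,
        mem_biUnion.2 ⟨A, hAW, mem_filter.2 ⟨hB.1, hA.2.trans hXB⟩⟩⟩)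
      exact ((hQ A).1 (hUQ hA.1)).1
  · intro A hA
    rw [hW, mem_filter] at hA
    exact hA.2.2
  · rw [mem_Ioc] at hi
    obtain ⟨h1, h2, m', hm', h3, h4⟩ := hr' i hi.1 hi.2
    refine card_minimal_le hs hm hm' (fun X hX => ((hQ X).1 hX).1) (fun X hX Y hY => ?_) hUQ hU
      hmax hr hqr hMr hqm h1 h2 h3 h4 hi.1.le (fun A hA => ?_)
    · obtain ⟨hXq, B, hB, hXB⟩ := (hQ X).1 hX
      exact (hQ Y).2 ⟨(card_le_card hY).trans hXq, B, hB, hY.trans hXB⟩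
    · rw [hW, mem_filter] at hA
      exact ⟨hA.1, hA.2.1, hA.2.2⟩

end Approximation

/-! ### Numerical estimates -/

section Numeric

/-- Each induction step costs a factor 4, since `(n + 1) ^ j ≤ 4 * n ^ j` follows from `(1 + 1 / n)
^ n ≤ e`. -/
theorem pow_mul_factorial_le (n j : ℕ) (hj : j ≤ n) :
    (n : ℝ) ^ j * (n - j).factorial ≤ 4 ^ j * n.factorial := by
  induction j generalizing n with
  | zero => simp
  | succ j ih =>
    obtain ⟨n, rfl⟩ : ∃ k, n = k + 1 := ⟨n - 1, by omega⟩
    have h1 := ih n (by omega)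
    have h2 : ((n + 1 : ℕ) : ℝ) ^ j ≤ 4 * (n : ℝ) ^ j := by
      rcases Nat.eq_zero_or_pos n with rfl | hn
      · obtain rfl : j = 0 := by omega
        simp
      · have hn' : (0 : ℝ) < n := by exact_mod_cast hn
        have h3 : (1 + 1 / (n : ℝ)) ^ j ≤ 4 := by
          calc (1 + 1 / (n : ℝ)) ^ j ≤ (1 + 1 / (n : ℝ)) ^ n :=
                pow_le_pow_right₀ (by linarith [one_div_pos.2 hn']) (by omega)
            _ ≤ (Real.exp (1 / n)) ^ n := by
                gcongr
                rw [add_comm]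
                exact Real.add_one_le_exp _
            _ = Real.exp 1 := by rw [← Real.exp_nat_mul]; congr 1; field_simp
            _ ≤ 4 := by linarith [Real.exp_one_lt_d9]
        calc ((n + 1 : ℕ) : ℝ) ^ j = (1 + 1 / (n : ℝ)) ^ j * (n : ℝ) ^ j := by
              rw [← mul_pow]; congr 1; push_cast; field_simp
          _ ≤ 4 * (n : ℝ) ^ j := by gcongr
    have h4 : n + 1 - (j + 1) = n - j := by omega
    rw [h4, Nat.factorial_succ]
    push_cast at h2 ⊢
    calc ((n : ℝ) + 1) ^ (j + 1) * (n - j).factorial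
        = (n + 1) * ((n + 1) ^ j * (n - j).factorial) := by ring
      _ ≤ (n + 1) * (4 * (n : ℝ) ^ j * (n - j).factorial) := by gcongr
      _ = (n + 1) * 4 * ((n : ℝ) ^ j * (n - j).factorial) := by ring
      _ ≤ (n + 1) * 4 * (4 ^ j * n.factorial) := by gcongr
      _ = _ := by ring

theorem rpow_le_two_pow_of_mul_logb_le (x : ℝ) (n : ℕ) (hn : 0 < n) {k : ℕ}
    (hk : x * Real.logb 2 n ≤ k) : (n : ℝ) ^ x ≤ 2 ^ k := by
  have hn' : (0 : ℝ) < n := by exact_mod_cast hn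
  calc (n : ℝ) ^ x = (2 : ℝ) ^ (x * Real.logb 2 n) := by
        rw [mul_comm, Real.rpow_mul (by norm_num), Real.rpow_logb (by norm_num) (by norm_num) hn']
    _ ≤ (2 : ℝ) ^ (k : ℝ) := Real.rpow_le_rpow_of_exponent_le (by norm_num) hk
    _ = 2 ^ k := Real.rpow_natCast _ _

theorem one_le_logb_two {i : ℕ} (hi : 2 ≤ i) : 1 ≤ Real.logb 2 i := by
  rw [Real.le_logb_iff_rpow_le (by norm_num) (by positivity)]
  rw [Real.rpow_one]
  exact_mod_cast hi

theorem logb_two_le (i : ℕ) : Real.logb 2 i ≤ i := by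
  rcases Nat.eq_zero_or_pos i with rfl | hi
  · simp
  · rw [Real.logb_le_iff_le_rpow (by norm_num) (by exact_mod_cast hi), Real.rpow_natCast]
    exact_mod_cast Nat.lt_two_pow_self.le

/-- With `d = i - t`, `log i ≤ log t + 2d/t ≤ log t * exp (2d/t)`; the `t`-th power costs `e ^ (2d)
≤ 8 ^ d`. -/
theorem logb_pow_le {t i : ℕ} (ht : 2 ≤ t) (hti : t ≤ i) :
    Real.logb 2 i ^ t ≤ Real.logb 2 t ^ t * 8 ^ (i - t) := by
  have ht0 : (0 : ℝ) < t := by positivity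
  have hi0 : (0 : ℝ) < i := by exact_mod_cast (by omega : 0 < i)
  have hl := one_le_logb_two ht
  have hij : ((i - t : ℕ) : ℝ) = i - t := Nat.cast_sub hti
  have hlog2 : (1 / 2 : ℝ) < Real.log 2 := by linarith [Real.log_two_gt_d9]
  set d : ℝ := ((i - t : ℕ) : ℝ) with hd
  have hd0 : 0 ≤ d := Nat.cast_nonneg _
  have h1 : Real.logb 2 i ≤ Real.logb 2 t + 2 * d / t := by
    have : (i : ℝ) = t * (1 + d / t) := by rw [hij]; field_simp; ring
    have hpos : 0 < 1 + d / t := by positivity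
    rw [this, Real.logb_mul ht0.ne' hpos.ne']
    gcongr
    have h2 : Real.log (1 + d / t) ≤ d / t := by
      have := Real.log_le_sub_one_of_pos hpos
      linarith
    rw [Real.logb, div_le_iff₀ (by linarith)]
    have h3 : 0 ≤ d / t := by positivity
    calc Real.log (1 + d / t) ≤ d / t := h2
      _ = 2 * (d / t) * (1 / 2) := by ring
      _ ≤ 2 * (d / t) * Real.log 2 := by gcongr
      _ = _ := by ring
  have h0 : 0 ≤ Real.logb 2 i := by
    linarith [one_le_logb_two (ht.trans hti)]
  have h2 : Real.logb 2 i ≤ Real.logb 2 t * Real.exp (2 * d / t) := by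
    have h3 : 0 ≤ 2 * d / t := by positivity
    calc Real.logb 2 i ≤ Real.logb 2 t + 2 * d / t := h1
      _ ≤ Real.logb 2 t + Real.logb 2 t * (2 * d / t) := by nlinarith
      _ = Real.logb 2 t * (2 * d / t + 1) := by ring
      _ ≤ _ := by gcongr; exact Real.add_one_le_exp _
  calc Real.logb 2 i ^ t ≤ (Real.logb 2 t * Real.exp (2 * d / t)) ^ t := by gcongr
    _ = Real.logb 2 t ^ t * Real.exp 2 ^ (i - t) := by
        rw [mul_pow, ← Real.exp_nat_mul, ← Real.exp_nat_mul]
        congr 2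
        rw [← hd]
        field_simp
    _ ≤ _ := by
        gcongr
        have : Real.exp 2 = Real.exp 1 * Real.exp 1 := by rw [← Real.exp_add]; norm_num
        rw [this]
        have := Real.exp_one_lt_d9
        have := Real.exp_pos 1
        nlinarith

theorem factorial_sub_mul_pow_le {n t i : ℕ} (hti : t ≤ i) (hin : 2 * i ≤ n) :
    ((n - i).factorial : ℝ) * ((n : ℝ) / 2) ^ (i - t) ≤ (n - t).factorial := by
  have h := Nat.factorial_mul_pow_le_factorial (m := n - i) (n := i - t)
  have he : n - i + (i - t) = n - t := by omega
  rw [he] at h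
  have h1 : (n : ℝ) / 2 ≤ ((n - i + 1 : ℕ) : ℝ) := by
    have : (n : ℝ) ≤ 2 * ((n - i + 1 : ℕ) : ℝ) := by exact_mod_cast (by omega)
    linarith
  calc _ ≤ ((n - i).factorial : ℝ) * ((n - i + 1 : ℕ) : ℝ) ^ (i - t) := by gcongr
    _ ≤ _ := by exact_mod_cast h

theorem sum_geometric_le {t q : ℕ} {y : ℝ} (hy0 : 0 ≤ y) (hy : y ≤ 1 / 2) :
    ∑ i ∈ Ioc t q, y ^ (i - t) ≤ 2 * y := by
  have h1 : ∀ k, ∑ i ∈ range k, y ^ i ≤ 2 := fun k => by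
    refine (Summable.sum_le_tsum (range k) (fun i _ => by positivity)
      (summable_geometric_of_lt_one hy0 (by linarith))).trans ?_
    rw [tsum_geometric_of_lt_one hy0 (by linarith), inv_le_comm₀ (by linarith) (by norm_num)]
    linarith
  have h2 : ∑ i ∈ Ioc t q, y ^ (i - t) = y * ∑ i ∈ range (q - t), y ^ i := by
    have : Ioc t q = Ico (t + 1) (q + 1) := by ext; simp only [mem_Ioc, mem_Ico]; omega
    rw [this, Finset.sum_Ico_eq_sum_range, Finset.mul_sum, Nat.add_sub_add_right]
    refine Finset.sum_congr rfl fun k _ => ?_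
    rw [← pow_succ', show t + 1 + k - t = k + 1 by omega]
  rw [h2]
  nlinarith [h1 (q - t)]

/-- Dividing by 8 rather than 4 in `pow_mul_factorial_le` gains `2 ^ j ≥ n ^ (t + 1)`, which beats
`n! / (n - t)! ≤ n ^ t` with a factor `n` to spare. -/
theorem small_remainder {n t q j : ℕ} (hn : 0 < n) (htn : t ≤ n) (hqj : q ≤ j) (hjn : j ≤ n)
    (hq : (n : ℝ) ^ (t + 1) ≤ 2 ^ q) :
    ((n - j).factorial : ℝ) * ((n : ℝ) / 8) ^ j ≤ (n - t).factorial / n := by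
  have hn' : (0 : ℝ) < n := by exact_mod_cast hn
  have h1 := pow_mul_factorial_le n j hjn
  have h2 : (n.factorial : ℝ) ≤ n ^ t * (n - t).factorial := by
    rw [← Nat.factorial_mul_descFactorial htn, mul_comm]
    push_cast
    gcongr
    exact_mod_cast Nat.descFactorial_le_pow n t
  have h3 : (2 : ℝ) ^ q ≤ 2 ^ j := pow_le_pow_right₀ (by norm_num) hqj
  rw [le_div_iff₀ hn', div_pow]
  have h8 : (8 : ℝ) ^ j = 4 ^ j * 2 ^ j := by rw [← mul_pow]; norm_num
  calc ((n - j).factorial : ℝ) * ((n : ℝ) ^ j / 8 ^ j) * n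
      = ((n : ℝ) ^ j * (n - j).factorial) * n / 8 ^ j := by ring
    _ ≤ (4 ^ j * n.factorial) * n / 8 ^ j := by gcongr
    _ ≤ (4 ^ j * (n ^ t * (n - t).factorial)) * n / 8 ^ j := by gcongr
    _ = (n : ℝ) ^ (t + 1) * (n - t).factorial / 2 ^ j := by rw [h8]; field_simp; ring
    _ ≤ (n - t).factorial := by
        rw [div_le_iff₀ (by positivity), mul_comm]
        gcongr
        exact hq.trans h3

end Numeric

/-! ### Choice of parameters and the final count -/

section Bound

variable {α : Type*} [Fintype α] [DecidableEq α]

/-- A factor 8 from the logarithms and 2 from the factorials turn `2 ^ 9` into `2 ^ 13` in the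
ratio. -/
theorem layer_term_le {n t i q s : ℕ} (hs : 1 ≤ s) (ht : 2 ≤ t) (hti : t ≤ i) (hn : 0 < n)
    (hin : 2 * i ≤ n) :
    ((2 : ℝ) ^ 9 * s * Real.logb 2 i) ^ t * ((2 : ℝ) ^ 9 * s * q) ^ (i - t) *
        (n - i).factorial ≤
      ((2 : ℝ) ^ 9 * s * Real.logb 2 t) ^ t * (n - t).factorial *
        ((2 : ℝ) ^ 13 * s * q / n) ^ (i - t) := by
  have hn' : (0 : ℝ) < n := by exact_mod_cast hn
  have h1 := logb_pow_le ht hti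
  have h2 := factorial_sub_mul_pow_le hti hin
  have hl : 0 ≤ Real.logb 2 t := by linarith [one_le_logb_two ht]
  have hy : ((2 : ℝ) ^ 13 * s * q / n) ^ (i - t) * ((n : ℝ) / 2) ^ (i - t) =
      8 ^ (i - t) * ((2 : ℝ) ^ 9 * s * q) ^ (i - t) := by
    rw [← mul_pow, ← mul_pow]; congr 1; field_simp; ring
  calc ((2 : ℝ) ^ 9 * s * Real.logb 2 i) ^ t * ((2 : ℝ) ^ 9 * s * q) ^ (i - t) *
        (n - i).factorial
      = ((2 : ℝ) ^ 9 * s) ^ t * Real.logb 2 i ^ t * ((2 : ℝ) ^ 9 * s * q) ^ (i - t) *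
        (n - i).factorial := by rw [mul_pow ((2 : ℝ) ^ 9 * s)]
    _ ≤ ((2 : ℝ) ^ 9 * s) ^ t * (Real.logb 2 t ^ t * 8 ^ (i - t)) *
        ((2 : ℝ) ^ 9 * s * q) ^ (i - t) * (n - i).factorial := by gcongr
    _ = ((2 : ℝ) ^ 9 * s * Real.logb 2 t) ^ t *
        (8 ^ (i - t) * ((2 : ℝ) ^ 9 * s * q) ^ (i - t)) * (n - i).factorial := by
        rw [mul_pow ((2 : ℝ) ^ 9 * s) (Real.logb 2 t)]; ring
    _ = ((2 : ℝ) ^ 9 * s * Real.logb 2 t) ^ t * ((2 : ℝ) ^ 13 * s * q / n) ^ (i - t) *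
        ((n - i).factorial * ((n : ℝ) / 2) ^ (i - t)) := by rw [← hy]; ring
    _ ≤ ((2 : ℝ) ^ 9 * s * Real.logb 2 t) ^ t * ((2 : ℝ) ^ 13 * s * q / n) ^ (i - t) *
        (n - t).factorial := by gcongr
    _ = _ := by ring

/-- The approximation theorem for families of `n`-element sets with the degrees of the family of
all permutations of `[n]`. -/
theorem exists_approximation_card_le {n s t : ℕ} (hn2 : 2 ≤ n) (hs : 1 ≤ s) (ht : 2 ≤ t)
    (hn : (2 : ℝ) ^ 20 * (s : ℝ) * ((t : ℝ) + 1) * Real.logb 2 (n : ℝ) ≤ (n : ℝ))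
    (F : Finset (Finset α)) (hFcard : ∀ B ∈ F, #B = n)
    (hdeg : ∀ Y : Finset α, #(F.filter fun B => Y ⊆ B) ≤ (n - #Y).factorial)
    (hF : FlowerFree s t F) :
    ∃ T : Finset (Finset α), (∀ A ∈ T, #A = t ∧ ∃ B ∈ F, A ⊆ B) ∧ FlowerFree s t T ∧
      (#(F.filter fun B => ∀ A ∈ T, ¬ A ⊆ B) : ℝ) ≤
        ((2 : ℝ) ^ 14 * (s : ℝ) * Real.logb 2 (t : ℝ)) ^ t *
          ((2 : ℝ) ^ 21 * (s : ℝ) * ((t : ℝ) + 1) * Real.logb 2 ((n : ℝ) / 4) / (n : ℝ)) *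
          (Nat.factorial (n - t) : ℝ) := by
  classical
  have hn0 : (0 : ℝ) < n := by positivity
  have hs1 : (1 : ℝ) ≤ s := by exact_mod_cast hs
  have ht2 : (2 : ℝ) ≤ t := by exact_mod_cast ht
  have hL1 := one_le_logb_two hn2
  have hLdef : Real.logb 2 ((n : ℝ) / 4) = Real.logb 2 n - 2 := by
    rw [Real.logb_div hn0.ne' (by norm_num), show (4 : ℝ) = 2 ^ (2 : ℝ) by norm_num,
      Real.logb_rpow (by norm_num) (by norm_num)]
  set L := Real.logb 2 (n : ℝ) with hL
  have hst : 3 ≤ (s : ℝ) * (t + 1) := by nlinarith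
  have hbig : (2 : ℝ) ^ 20 ≤ n := by
    have h1 : 1 ≤ (s : ℝ) * (t + 1) * L := by nlinarith
    calc (2 : ℝ) ^ 20 ≤ 2 ^ 20 * ((s : ℝ) * (t + 1) * L) := by linarith
      _ ≤ (n : ℝ) := by linarith
  have hL20 : 20 ≤ L := by
    rw [hL, Real.le_logb_iff_rpow_le (by norm_num) hn0]
    exact_mod_cast hbig
  set Q : ℝ := (t + 1) * L with hQ
  have hQL : 3 * L ≤ Q := by nlinarith
  have hsQ : (2 : ℝ) ^ 20 * (s * Q) ≤ n := by rw [hQ]; linarith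
  have hQsQ : Q ≤ s * Q := by nlinarith
  -- Chosen so that `2 ^ q ≥ n ^ (t + 1)`, as `small_remainder` needs.
  set q : ℕ := ⌈Q⌉₊ with hqdef
  have hqQ : Q ≤ q := Nat.le_ceil _
  have hqQ' : (q : ℝ) ≤ 2 * Q := by linarith [Nat.ceil_lt_add_one (show 0 ≤ Q by linarith)]
  -- This makes `2 ^ m ≥ 2 * n ^ 2 > n * s`.
  set m : ℕ := ⌈2 * L⌉₊ + 1 with hmdef
  have hm1 : 2 * L + 1 ≤ m := by rw [hmdef]; push_cast; linarith [Nat.le_ceil (2 * L)]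
  have hm2 : (m : ℝ) ≤ 3 * L := by
    rw [hmdef]; push_cast; linarith [Nat.ceil_lt_add_one (show 0 ≤ 2 * L by linarith)]
  have hsqQ : (s : ℝ) * q ≤ 2 * (s * Q) := by nlinarith
  have hsm : (s : ℝ) * m ≤ s * Q := by gcongr; linarith
  have hsq : (s : ℝ) * Q ≤ s * q := by gcongr
  have hq2n : 2 * q ≤ n := by
    have : (2 : ℝ) * q ≤ n := by linarith
    exact_mod_cast this
  have hsn : s ≤ n := by
    have : (s : ℝ) ≤ n := by nlinarith
    exact_mod_cast this
  have hnm : n * s < 2 ^ m := by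
    have h1 := rpow_le_two_pow_of_mul_logb_le 2 n (by omega) (k := ⌈2 * L⌉₊) (Nat.le_ceil _)
    have h2 : n ^ 2 ≤ 2 ^ ⌈2 * L⌉₊ := by exact_mod_cast h1
    rw [hmdef, pow_succ]
    nlinarith
  have hqm : q * s < 2 ^ m := lt_of_le_of_lt (Nat.mul_le_mul_right s (by omega)) hnm
  have hq0 : (0 : ℝ) < s * q := by nlinarith
  -- The rate `n / 8` fits `small_remainder`. Lifting within `U` must avoid up to `s * q` points,
  -- whence `r`; the sunflower found inside layer `i` needs only about `s * log i`, whence `r'`.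
  obtain ⟨T, hT, hTfree, F', W, hcover, hF', hW⟩ := exists_approximation (q := q) (m := m)
    (p := (n : ℝ) / 8) (r := 2 ^ 9 * s * q) (r' := fun i => 2 ^ 9 * s * Real.logb 2 i)
    hs (by omega) F (fun B hB => (hFcard B hB).le) hF (by positivity) (by linarith) (by linarith)
    hnm (by linarith) (by linarith) (by linarith) hqm (fun i hti hiq => by
      have hl := one_le_logb_two (show 2 ≤ i by omega)
      refine ⟨by positivity, ?_, ⌈Real.logb 2 i⌉₊ + 1, by omega, ?_, ?_⟩
      · have : (i : ℝ) ≤ q := by exact_mod_cast hiq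
        have := (logb_two_le i).trans this
        gcongr
      · push_cast
        have := Nat.ceil_lt_add_one (show 0 ≤ Real.logb 2 i by linarith)
        nlinarith
      · have h1 := rpow_le_two_pow_of_mul_logb_le 1 i (by omega) (k := ⌈Real.logb 2 i⌉₊)
          (by rw [one_mul]; exact Nat.le_ceil _)
        rw [Real.rpow_one] at h1
        have h2 : i ≤ 2 ^ ⌈Real.logb 2 i⌉₊ := by exact_mod_cast h1
        rw [pow_succ]
        omega)
  refine ⟨T, hT, hTfree, ?_⟩
  have htn : t ≤ n := by
    have : (t : ℝ) ≤ n := by nlinarith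
    exact_mod_cast this
  have hlt := one_le_logb_two ht
  set y : ℝ := (2 : ℝ) ^ 13 * s * q / n with hy
  have hy0 : 0 ≤ y := by positivity
  have hy1 : y ≤ 1 / 2 := by
    rw [hy, div_le_iff₀ hn0]; linarith
  set K : ℝ := ((2 : ℝ) ^ 9 * s * Real.logb 2 t) ^ t with hK
  have hK1 : 1 ≤ K := one_le_pow₀ (by nlinarith)
  have hrem : (#F' : ℝ) ≤ (n - t).factorial / n := by
    rcases hF' with h | ⟨Y, hY, hFY⟩
    · rw [h, card_empty, Nat.cast_zero]; positivity
    · rcases (F.filter fun B => Y ⊆ B).eq_empty_or_nonempty with h | ⟨B, hB⟩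
      · rw [h, card_empty, Nat.cast_zero, zero_mul] at hFY
        exact hFY.trans (by positivity)
      · rw [mem_filter] at hB
        have hYn : #Y ≤ n := (card_le_card hB.2).trans_eq (hFcard B hB.1)
        have hd : (#(F.filter fun B => Y ⊆ B) : ℝ) ≤ (n - #Y).factorial := by
          exact_mod_cast hdeg Y
        refine hFY.trans (le_trans (by gcongr)
          (small_remainder (by omega) htn hY.le hYn ?_))
        have h1 := rpow_le_two_pow_of_mul_logb_le ((t + 1 : ℕ) : ℝ) n (by omega) (k := q)
          (by push_cast; exact hqQ)
        rwa [Real.rpow_natCast] at h1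
  have hlayers : ∀ i ∈ Ioc t q,
      (#((W i).biUnion fun A => F.filter fun B => A ⊆ B) : ℝ) ≤
        K * (n - t).factorial * y ^ (i - t) := by
    intro i hi
    obtain ⟨hWi, hWcard⟩ := hW i hi
    rw [mem_Ioc] at hi
    have h1 : #((W i).biUnion fun A => F.filter fun B => A ⊆ B) ≤ #(W i) * (n - i).factorial :=
      card_biUnion_le_card_mul _ _ _ fun A hA => by
        have := hdeg A
        rwa [hWi A hA] at this
    have h2 : (#((W i).biUnion fun A => F.filter fun B => A ⊆ B) : ℝ) ≤
        #(W i) * (n - i).factorial := by exact_mod_cast h1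
    refine h2.trans (le_trans ?_ (layer_term_le hs ht hi.1.le (by omega) (by omega)))
    gcongr
  have htotal : (#(F.filter fun B => ∀ A ∈ T, ¬ A ⊆ B) : ℝ) ≤
      (n - t).factorial / n + K * (n - t).factorial * (2 * y) := by
    have h1 := (card_le_card hcover).trans (card_union_le _ _)
    have h2 : (#(F.filter fun B => ∀ A ∈ T, ¬ A ⊆ B) : ℝ) ≤
        #F' + ∑ i ∈ Ioc t q, (#((W i).biUnion fun A => F.filter fun B => A ⊆ B) : ℝ) := by
      exact_mod_cast h1.trans (Nat.add_le_add_left card_biUnion_le _)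
    have h3 := Finset.sum_le_sum hlayers
    rw [← Finset.mul_sum] at h3
    have h4 : K * (n - t).factorial * ∑ i ∈ Ioc t q, y ^ (i - t) ≤
        K * (n - t).factorial * (2 * y) := by
      gcongr
      exact sum_geometric_le hy0 hy1
    linarith
  have hKK : K ≤ ((2 : ℝ) ^ 14 * s * Real.logb 2 t) ^ t := by
    rw [hK]
    gcongr <;> norm_num
  have hfac : (0 : ℝ) < (n - t).factorial := by positivity
  -- Since `L ≥ 20`, replacing `L` by `L - 2`, the logarithm of `n / 4`, costs at most a factor 2.
  have hend : 1 / (n : ℝ) + 2 * y ≤ 2 ^ 21 * s * (t + 1) * Real.logb 2 ((n : ℝ) / 4) / n := by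
    rw [hLdef, hy, ← mul_div_assoc, ← add_div]
    gcongr
    have : (s : ℝ) * Q ≤ 2 * (s * (t + 1) * (L - 2)) := by
      have h1 : L ≤ 2 * (L - 2) := by linarith
      calc (s : ℝ) * Q = s * (t + 1) * L := by rw [hQ]; ring
        _ ≤ s * (t + 1) * (2 * (L - 2)) := by gcongr
        _ = _ := by ring
    linarith
  calc (#(F.filter fun B => ∀ A ∈ T, ¬ A ⊆ B) : ℝ)
      ≤ (n - t).factorial / n + K * (n - t).factorial * (2 * y) := htotal
    _ = 1 * (1 / (n : ℝ)) * (n - t).factorial + K * (2 * y) * (n - t).factorial := by ring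
    _ ≤ K * (1 / (n : ℝ)) * (n - t).factorial + K * (2 * y) * (n - t).factorial := by gcongr
    _ = K * (1 / (n : ℝ) + 2 * y) * (n - t).factorial := by ring
    _ ≤ _ := by gcongr

end Bound

/-! ### Permutations and partial permutations as graphs -/

section Permutations

variable {n : ℕ}

/-- The graph of a permutation. -/
def permGraph (σ : Equiv.Perm (Fin n)) : Finset (Fin n × Fin n) :=
  univ.filter fun p => σ p.1 = p.2

theorem mem_permGraph (σ : Equiv.Perm (Fin n)) (p : Fin n × Fin n) :
    p ∈ permGraph σ ↔ σ p.1 = p.2 := by simp [permGraph]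

theorem permGraph_injective : Function.Injective (permGraph (n := n)) := by
  intro σ τ h
  ext x
  have : (x, σ x) ∈ permGraph τ := by rw [← h, mem_permGraph]
  rw [mem_permGraph] at this
  exact congrArg Fin.val this.symm

theorem card_image_fst_of_subset_permGraph {σ : Equiv.Perm (Fin n)} {A : Finset (Fin n × Fin n)}
    (hA : A ⊆ permGraph σ) : #(A.image Prod.fst) = #A := by
  refine card_image_of_injOn fun p hp q hq hpq => ?_
  have h1 := (mem_permGraph σ p).1 (hA hp)
  have h2 := (mem_permGraph σ q).1 (hA hq)
  exact Prod.ext hpq (by rw [← h1, ← h2]; exact congrArg σ hpq)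

theorem card_permGraph (σ : Equiv.Perm (Fin n)) : #(permGraph σ) = n := by
  rw [← card_image_fst_of_subset_permGraph (Subset.refl (permGraph σ))]
  have : (permGraph σ).image Prod.fst = univ := by
    ext x
    simp only [mem_image, mem_univ, iff_true]
    exact ⟨(x, σ x), by rw [mem_permGraph], rfl⟩
  rw [this, card_univ, Fintype.card_fin]

theorem card_fixing (D : Finset (Fin n)) :
    #(univ.filter fun τ : Equiv.Perm (Fin n) => ∀ x ∈ D, τ x = x) = (n - #D).factorial := by
  classical
  have h1 := Fintype.card_congr (Equiv.Perm.subtypeEquivSubtypePerm fun x : Fin n => x ∉ D)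
  rw [Fintype.card_perm, Fintype.card_subtype, Fintype.card_subtype] at h1
  have h2 : #(univ.filter fun x : Fin n => x ∉ D) = n - #D := by
    rw [← compl_filter, card_compl, Fintype.card_fin]; simp
  rw [h2] at h1
  rw [h1]
  congr 1
  ext τ
  simp

/-- Composing with the inverse of one such permutation gives permutations fixing the first
coordinates of `Y`. -/
theorem card_filter_subset_permGraph_le (Y : Finset (Fin n × Fin n)) :
    #(univ.filter fun σ : Equiv.Perm (Fin n) => Y ⊆ permGraph σ) ≤ (n - #Y).factorial := by
  classical
  rcases (univ.filter fun σ : Equiv.Perm (Fin n) => Y ⊆ permGraph σ).eq_empty_or_nonempty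
    with h | ⟨σ₀, h₀⟩
  · rw [h]; simp
  · have h₀' : Y ⊆ permGraph σ₀ := (mem_filter.1 h₀).2
    rw [← card_image_fst_of_subset_permGraph h₀', ← card_fixing]
    refine Finset.card_le_card_of_injOn (fun σ => σ₀⁻¹ * σ) ?_ (mul_right_injective _).injOn
    intro σ hσ
    have hσ' : Y ⊆ permGraph σ := by simpa using hσ
    simp only [coe_filter, mem_univ, true_and, Set.mem_ofPred_eq, mem_image]
    rintro x ⟨p, hp, rfl⟩
    rw [Equiv.Perm.mul_apply, (mem_permGraph σ p).1 (hσ' hp), ← (mem_permGraph σ₀ p).1 (h₀' hp)]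
    simp

/-- The graph of a partial permutation. -/
def partialGraph (ν : Fin n ≃. Fin n) : Finset (Fin n × Fin n) :=
  univ.filter fun p => ν p.1 = some p.2

theorem mem_partialGraph (ν : Fin n ≃. Fin n) (p : Fin n × Fin n) :
    p ∈ partialGraph ν ↔ ν p.1 = some p.2 := by simp [partialGraph]

theorem card_image_fst_of_subset_partialGraph {ν : Fin n ≃. Fin n} {A : Finset (Fin n × Fin n)}
    (hA : A ⊆ partialGraph ν) : #(A.image Prod.fst) = #A := by
  refine card_image_of_injOn fun p hp q hq hpq => ?_
  have h1 := (mem_partialGraph ν p).1 (hA hp)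
  have h2 := (mem_partialGraph ν q).1 (hA hq)
  have h3 : p.1 = q.1 := hpq
  rw [h3, h2] at h1
  exact Prod.ext hpq (Option.some_injective _ h1).symm

theorem ncard_support (ν : Fin n ≃. Fin n) :
    (PermSunflower.support ν).ncard = #(partialGraph ν) := by
  rw [← card_image_fst_of_subset_partialGraph (Subset.refl _), ← Set.ncard_coe_finset]
  congr 1
  ext x
  simp only [PermSunflower.support, Set.mem_ofPred_eq, coe_image, Set.mem_image, mem_coe,
    mem_partialGraph]
  constructor
  · rintro ⟨y, hy⟩
    exact ⟨(x, y), hy, rfl⟩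
  · rintro ⟨p, hp, rfl⟩
    exact ⟨p.2, hp⟩

theorem exists_partialGraph_eq {σ : Equiv.Perm (Fin n)} {A : Finset (Fin n × Fin n)}
    (hA : A ⊆ permGraph σ) : ∃ ν : Fin n ≃. Fin n, partialGraph ν = A := by
  classical
  refine ⟨(PEquiv.ofSet ((A.image Prod.fst : Finset (Fin n)) : Set (Fin n))).trans σ.toPEquiv, ?_⟩
  ext ⟨x, y⟩
  rw [mem_partialGraph, ← Option.mem_def, PEquiv.mem_trans]
  constructor
  · rintro ⟨z, hz, hy⟩
    rw [PEquiv.mem_ofSet_iff] at hz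
    obtain ⟨rfl, hz⟩ := hz
    obtain ⟨p, hp, hpz⟩ := mem_image.1 (mem_coe.1 hz)
    have h1 := (mem_permGraph σ p).1 (hA hp)
    have h2 : σ z = y := by simpa [Equiv.toPEquiv_apply] using hy
    have : p = (z, y) := Prod.ext hpz (by rw [← h1, hpz, h2])
    exact this ▸ hp
  · intro h
    have h1 : σ x = y := (mem_permGraph σ _).1 (hA h)
    refine ⟨x, ?_, by simp [Equiv.toPEquiv_apply, h1]⟩
    rw [PEquiv.mem_ofSet_iff]
    exact ⟨rfl, mem_coe.2 (mem_image.2 ⟨_, h, rfl⟩)⟩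

theorem flowerFree_image_permGraph {s t : ℕ} (F : Finset (Equiv.Perm (Fin n)))
    (ht : 1 ≤ t) (hF : ¬ PermSunflower.HasSunflower (F : Set (Equiv.Perm (Fin n))) s (t - 1)) :
    FlowerFree s t (F.image permGraph) := by
  classical
  intro A C hA hC
  by_contra! hCt
  have hA' : ∀ j, ∃ σ ∈ F, permGraph σ = A j := fun j => mem_image.1 (hA j)
  choose σ hσ hσA using hA'
  refine hF ⟨σ, C.image Prod.fst, hσ, card_image_le.trans (by omega), ?_, ?_⟩
  · intro x hx i j
    obtain ⟨p, hp, rfl⟩ := mem_image.1 hx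
    have h : ∀ j, σ j p.1 = p.2 := fun j =>
      (mem_permGraph _ _).1 (by rw [hσA]; exact hC.1 j hp)
    rw [h i, h j]
  · intro x hx i j hij h
    refine hx (mem_image.2 ⟨(x, σ i x), hC.2 i j hij (mem_inter.2 ⟨?_, ?_⟩), rfl⟩)
    · rw [← hσA, mem_permGraph]
    · rw [← hσA, mem_permGraph, h]

theorem not_hasPartialSunflower {s t : ℕ} (hs : 1 ≤ s) (ht : 1 ≤ t)
    (T : Finset (Finset (Fin n × Fin n))) (hT : FlowerFree s t T) :
    ¬ PermSunflower.HasPartialSunflower {ν : Fin n ≃. Fin n | partialGraph ν ∈ T} s (t - 1) := by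
  classical
  rintro ⟨ν, X, hν, hX, hcore, hpetal⟩
  set j₀ : Fin s := ⟨0, hs⟩
  -- All petals agree over `X`, so the core can be read off from any one of them; `s ≥ 1` provides
  -- `j₀`.
  have h := hT (fun j => partialGraph (ν j)) ((partialGraph (ν j₀)).filter fun p => p.1 ∈ X) hν
    ⟨fun j p hp => ?_, fun i j hij p hp => ?_⟩
  · have h2 : #((partialGraph (ν j₀)).filter fun p => p.1 ∈ X) ≤ #X := by
      rw [← card_image_fst_of_subset_partialGraph (ν := ν j₀) (filter_subset _ _)]
      refine card_le_card fun x hx => ?_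
      obtain ⟨p, hp, rfl⟩ := mem_image.1 hx
      exact (mem_filter.1 hp).2
    omega
  · rw [mem_filter, mem_partialGraph] at hp
    obtain ⟨y, hy⟩ := hcore p.1 hp.2
    rw [mem_partialGraph, hy j, ← hy j₀, hp.1]
  · rw [mem_inter, mem_partialGraph, mem_partialGraph] at hp
    have hpX : p.1 ∈ X := by
      by_contra hpX
      exact hpetal p.1 hpX i j hij p.2 p.2 hp.1 hp.2 rfl
    obtain ⟨y, hy⟩ := hcore p.1 hpX
    rw [mem_filter, mem_partialGraph, hy j₀, ← hy i, hp.1]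
    exact ⟨rfl, hpX⟩

end Permutations

end SpreadApprox

theorem mainTheorem7 (n s t : ℕ) (hn2 : 2 ≤ n) (hs : 1 ≤ s) (ht : 2 ≤ t)
    (hn : (2 : ℝ) ^ 20 * (s : ℝ) * ((t : ℝ) + 1) * Real.logb 2 (n : ℝ) ≤ (n : ℝ))
    (F : Set (Equiv.Perm (Fin n)))
    (hF : ¬ PermSunflower.HasSunflower F s (t - 1)) :
    ∃ T : Set (Fin n ≃. Fin n),
      T ⊆ PermSunflower.partialPerms n t ∧
      ¬ PermSunflower.HasPartialSunflower T s (t - 1) ∧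
      ((F \ PermSunflower.restrictTo F T).ncard : ℝ) ≤
        ((2 : ℝ) ^ 14 * (s : ℝ) * Real.logb 2 (t : ℝ)) ^ t *
          ((2 : ℝ) ^ 21 * (s : ℝ) * ((t : ℝ) + 1) * Real.logb 2 ((n : ℝ) / 4) / (n : ℝ)) *
          (Nat.factorial (n - t) : ℝ) := by
  classical
  obtain ⟨F, rfl⟩ := F.toFinite.exists_finset_coe
  obtain ⟨T, hT, hTfree, hbound⟩ := SpreadApprox.exists_approximation_card_le hn2 hs ht hn
    (F.image SpreadApprox.permGraph)
    (fun B hB => by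
      obtain ⟨σ, _, rfl⟩ := Finset.mem_image.1 hB
      exact SpreadApprox.card_permGraph σ)
    (fun Y => by
      refine le_trans ?_ (SpreadApprox.card_filter_subset_permGraph_le Y)
      rw [Finset.filter_image]
      exact Finset.card_image_le.trans
        (Finset.card_le_card (Finset.filter_subset_filter _ (Finset.subset_univ F))))
    (SpreadApprox.flowerFree_image_permGraph F (by omega) hF)
  refine ⟨{ν | SpreadApprox.partialGraph ν ∈ T}, fun ν hν => ?_,
    SpreadApprox.not_hasPartialSunflower hs (by omega) T hTfree, le_trans ?_ hbound⟩
  · exact (SpreadApprox.ncard_support ν).trans (hT _ hν).1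
  -- A set in `T` contained in the graph of `σ` is the graph of a partial permutation, which then
  -- coincides with `σ` on its support.
  · have hsub : ((F : Set (Equiv.Perm (Fin n))) \ PermSunflower.restrictTo F
        {ν | SpreadApprox.partialGraph ν ∈ T}) ⊆
        ((F.filter fun σ => ∀ A ∈ T, ¬ A ⊆ SpreadApprox.permGraph σ :
          Finset (Equiv.Perm (Fin n))) : Set (Equiv.Perm (Fin n))) := by
      rintro σ ⟨hσF, hσ⟩
      refine Finset.mem_coe.2 (Finset.mem_filter.2 ⟨hσF, fun A hA hAσ => hσ ⟨hσF, ?_⟩⟩)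
      obtain ⟨ν, rfl⟩ := SpreadApprox.exists_partialGraph_eq hAσ
      refine ⟨ν, hA, ?_⟩
      rintro x ⟨y, hy⟩
      have h1 := hAσ ((SpreadApprox.mem_partialGraph ν (x, y)).2 hy)
      rw [SpreadApprox.mem_permGraph] at h1
      exact hy.trans (congrArg some h1.symm)
    have h1 := Set.ncard_le_ncard hsub (Finset.finite_toSet _)
    rw [Set.ncard_coe_finset] at h1
    rw [Finset.filter_image, Finset.card_image_of_injective _ SpreadApprox.permGraph_injective]
    exact_mod_cast h1
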